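/- **Setting.** Let $\mathcal X$ be a measurable space, $\mathcal Y\subset\mathbb R^d$ compact and convex, $\mathcal D$ a probability distribution on $\mathcal X\times\mathcal Y$, and $\mathcal A$ a finite set of actions. Let $\mathcal H$ be a separable real reproducing kernel Hilbert space of functions on $\mathcal Y$ with kernel $K$ and measurable feature map $\phi(y)=K(y,\cdot)$ satisfying $\|\phi(y)\|_{\mathcal H}\le R_2$ for all $y$. Let $R_1,R_2,\beta>0$ and $$\mathcal L_{\mathcal H}=\{\ell:\mathcal A\times\mathcal Y\to\mathbb R \;:\; \ell(a,\cdot)\in\mathcal H,\ \|\ell(a,\cdot)\|_{\mathcal H}\le R_1\ \text{ for all } a\},\qquad r_\ell(a)=\ell(a,\cdot).$$ A predictor $p:\mathcal X\to\mathcal H$ defines the loss estimator $f_p(x,a,\ell)=\langle r_\ell(a),p(x)\rangle_{\mathcal H}$ and the smooth optimal decision rules $$\tilde k_{f_p,\ell}(x,a)=\frac{e^{-\beta f_p(x,a,\ell)}}{\sum_{a'}e^{-\beta f_p(x,a',\ell)}},\qquad \tilde{\mathcal K}_{\mathcal L_{\mathcal H}}=\{\tilde k_{f_p,\ell'}:\ell'\in\mathcal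 L_{\mathcal H}\}.$$ The estimator $f_p$ is $(\mathcal L_{\mathcal H},\tilde{\mathcal K}_{\mathcal L_{\mathcal H}},\epsilon)$-decision calibrated if $$\sup_{\ell\in\mathcal L_{\mathcal H},\,k\in\tilde{\mathcal K}_{\mathcal L_{\mathcal H}}}\Big|\mathbb E_{\mathcal D}\sum_a k(x,a)\,\ell(a,y)-\mathbb E_{\mathcal D}\sum_a k(x,a)\,f_p(x,a,\ell)\Big|\le\epsilon .$$ **Algorithm (DimFreeDeCal).** Input: a measurable predictor $p_0$ with $\|p_0(x)\|_{\mathcal H}\le R_2$ for all $x$, a tolerance $\epsilon>0$, the step size $\eta=\epsilon/(2R_1^2)$, and a batch size $n$. Set $t=0$. While $$\sup_{\ell,\ell'\in\mathcal L_{\mathcal H}}\mathbb E_{\mathcal D}\Big[\Big\langle\sum_a r_\ell(a)\,\tilde k_{f_{p_t},\ell'}(x,a),\ \phi(y)-p_t(x)\Big\rangle\Big]>\epsilon :$$ draw a fresh batch of $n$ i.i.d. samples from $\mathcal D$, with empirical expectation $\hat{\mathbb E}$; by an auditing oracle find $\ell_t,\ell_t'\in\mathcal L_{\mathcal H}$ with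 $$\hat{\mathbb E}\Big[\Big\langle\sum_a r_{\ell_t}(a)\,\tilde k_{f_{p_t},\ell_t'}(x,a),\ \phi(y)-p_t(x)\Big\rangle\Big]>\tfrac{3\epsilon}{4};$$ put $v_{ta}=\hat{\mathbb E}[(\phi(y)-p_t(x))\,\tilde k_{f_{p_t},\ell_t'}(x,a)]$ and $d_{ta}=\eta R_1 v_{ta}/\|v_{ta}\|_{\mathcal H}$ (with $d_{ta}=0$ if $v_{ta}=0$); set $$p_{t+1}(x)=\pi_{B(R_2)}\Big(p_t(x)+\sum_a d_{ta}\,\tilde k_{f_{p_t},\ell_t'}(x,a)\Big),$$ where $\pi_{B(R_2)}$ is the projection onto the closed ball of radius $R_2$ in $\mathcal H$; and increase $t$ by one. The oracle is any measurable function of the batches drawn so far (the current one included) that returns such a pair whenever one exists. **Theorem.** There are universal constants $C>0$ and $k\in\mathbb N$ such that, for all $\beta,R_1,R_2,\epsilon>0$, $\delta\in(0,1)$ and $m\in\mathbb N$, there is a number $n_0$, depending only on these six parameters, with $$n_0\cdot\frac{16R_1^2R_2^2}{\epsilon^2}\ \le\ \frac{C\,(1+m+\beta+R_1+R_2)^k\,\big(1+\log(1+\tfrac1\epsilon)+\log\tfrac1\delta\big)^k}{\epsilon^4},$$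 such that the following holds in every setting as above with $|\mathcal A|=m$, for every initial predictor, every auditing oracle and every batch size $n\ge n_0$. With probability at least $1-\delta$ over the samples, the search step succeeds in every iteration, and the algorithm stops after $T\le 16R_1^2R_2^2/\epsilon^2$ iterations (so that with $n=n_0$ it uses $Tn_0=\tilde O(1/\epsilon^4)$ samples in total) and outputs a predictor $p_T$ such that 1. $f_{p_T}$ is $(\mathcal L_{\mathcal H},\tilde{\mathcal K}_{\mathcal L_{\mathcal H}},\epsilon)$-decision calibrated; 2. $\mathbb E_{\mathcal D}\|p_T(x)-\phi(y)\|_{\mathcal H}^2\le\mathbb E_{\mathcal D}\|p_0(x)-\phi(y)\|_{\mathcal H}^2$; 3. if $p_0(x)=\sum_{i=1}^{N_0}\alpha_i(x)\phi(y_i)$ for finitely many outcomes $y_i\in\mathcal Y$ and functions $\alpha_i:\mathcal X\to\mathbb R$, then $p_T$ also has such a form. -/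

import Mathlib

open MeasureTheory
open scoped ENNReal

namespace DimFreeDeCal

noncomputable section

/-- The canonical feature map `φ(y) = K(y, ·)` of a real reproducing kernel Hilbert space `H` of
functions on `Y`. -/
def featureMap {Y : Type*} (H : Type*) [NormedAddCommGroup H] [InnerProductSpace ℝ H]
    [CompleteSpace H] [RKHS ℝ H Y ℝ] (y : Y) : H :=
  RKHS.kerFun H y (1 : ℝ)

/-- The loss functions `ℓ : A × Y → ℝ` with `ℓ(a, ·) ∈ H` and `‖ℓ(a, ·)‖ ≤ R₁` for every action
`a`. A loss is stored as the map `a ↦ ℓ(a, ·)`, so that `ℓ a y` is the loss of action `a` under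
outcome `y`, and `ℓ a`, as a vector of `H`, is the coefficient vector of that action. -/
def lossClass (A H : Type*) [NormedAddCommGroup H] (R₁ : ℝ) : Set (A → H) :=
  {ℓ | ∀ a, ‖ℓ a‖ ≤ R₁}

/-- The loss estimator `f_p(x, a, ℓ) = ⟪ℓ(a, ·), p(x)⟫` of a predictor `p : X → H`. -/
def lossEstimator {X A H : Type*} [NormedAddCommGroup H] [InnerProductSpace ℝ H]
    (p : X → H) (x : X) (a : A) (ℓ : A → H) : ℝ :=
  inner ℝ (ℓ a) (p x)

/-- The smooth optimal decision rule (quantal response) of a decision maker with loss `ℓ` who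
relies on the loss estimator `f`. -/
def smoothRule {X A L : Type*} [Fintype A] (β : ℝ) (f : X → A → L → ℝ) (ℓ : L) (x : X) (a : A) :
    ℝ :=
  Real.exp (-β * f x a ℓ) / ∑ a', Real.exp (-β * f x a' ℓ)

/-- The class of smooth optimal decision rules induced by the losses of a class `𝓛`. -/
def smoothRules {X A L : Type*} [Fintype A] (β : ℝ) (f : X → A → L → ℝ) (𝓛 : Set L) :
    Set (X → A → ℝ) :=
  {k | ∃ ℓ ∈ 𝓛, k = smoothRule β f ℓ}

/-- The decision calibration error of a loss estimator `f` with respect to a class `𝓛` of losses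
and a class `𝓚` of decision rules: the supremum over `ℓ ∈ 𝓛`, `k ∈ 𝓚` of the distance between the
true and the estimated expected loss. -/
def decCalError {X Y A H : Type*} [MeasurableSpace X] [MeasurableSpace Y] [Fintype A]
    [NormedAddCommGroup H] [InnerProductSpace ℝ H] [RKHS ℝ H Y ℝ]
    (D : Measure (X × Y)) (f : X → A → (A → H) → ℝ) (𝓛 : Set (A → H)) (𝓚 : Set (X → A → ℝ)) :
    ℝ≥0∞ :=
  ⨆ ℓ ∈ 𝓛, ⨆ k ∈ 𝓚, ENNReal.ofReal
    |(∫ z, ∑ a, k z.1 a * ℓ a z.2 ∂D) - ∫ z, ∑ a, k z.1 a * f z.1 a ℓ ∂D|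

/-- `(𝓛, 𝓚, ε)`-decision calibration of a loss estimator. -/
def IsDecCalibrated {X Y A H : Type*} [MeasurableSpace X] [MeasurableSpace Y] [Fintype A]
    [NormedAddCommGroup H] [InnerProductSpace ℝ H] [RKHS ℝ H Y ℝ]
    (D : Measure (X × Y)) (f : X → A → (A → H) → ℝ) (𝓛 : Set (A → H)) (𝓚 : Set (X → A → ℝ))
    (ε : ℝ) : Prop :=
  decCalError D f 𝓛 𝓚 ≤ ENNReal.ofReal ε

/-- The predictor `p` has the form `p(x) = ∑ i, α_i(x) φ(y_i)` with finitely many outcomes `y_i`. -/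
def HasFiniteExpansion {X Y H : Type*} [NormedAddCommGroup H] [InnerProductSpace ℝ H]
    [CompleteSpace H] [RKHS ℝ H Y ℝ] (p : X → H) : Prop :=
  ∃ (N : ℕ) (α : Fin N → X → ℝ) (y : Fin N → Y), ∀ x, p x = ∑ i, α i x • featureMap H (y i)

/-- The mean squared error `𝔼 ‖p(x) - φ(y)‖²`. -/
def meanSquaredError {X Y H : Type*} [MeasurableSpace X] [MeasurableSpace Y]
    [NormedAddCommGroup H] [InnerProductSpace ℝ H] [CompleteSpace H] [RKHS ℝ H Y ℝ]
    (D : Measure (X × Y)) (p : X → H) : ℝ :=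
  ∫ z, ‖p z.1 - featureMap H z.2‖ ^ 2 ∂D

/-- The empirical expectation of `ψ` over the sample `S`. -/
def empMean {Z E : Type*} [AddCommGroup E] [Module ℝ E] {n : ℕ} (S : Fin n → Z) (ψ : Z → E) : E :=
  (n : ℝ)⁻¹ • ∑ i, ψ (S i)

/-- The integrand `⟪∑ a, r_ℓ(a) k̃_{ℓ'}(x, a), φ(y) - p(x)⟫` at `z = (x, y)`, where `k̃_{ℓ'}` is the
smooth optimal decision rule for `ℓ'` and `f_p`. -/
def gap {X Y A H : Type*} [Fintype A] [NormedAddCommGroup H] [InnerProductSpace ℝ H]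
    [CompleteSpace H] [RKHS ℝ H Y ℝ] (β : ℝ) (p : X → H) (ℓ ℓ' : A → H) (z : X × Y) : ℝ :=
  inner ℝ (∑ a, smoothRule β (lossEstimator p) ℓ' z.1 a • ℓ a) (featureMap H z.2 - p z.1)

/-- The test of the `while` loop: the supremum of the expected gap over all pairs of losses
exceeds `ε`. -/
def LoopTest {X Y A H : Type*} [MeasurableSpace X] [MeasurableSpace Y] [Fintype A]
    [NormedAddCommGroup H] [InnerProductSpace ℝ H] [CompleteSpace H] [RKHS ℝ H Y ℝ]
    (𝓛 : Set (A → H)) (D : Measure (X × Y)) (β ε : ℝ) (p : X → H) : Prop :=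
  (ε : EReal) < ⨆ ℓ ∈ 𝓛, ⨆ ℓ' ∈ 𝓛, ((∫ z, gap β p ℓ ℓ' z ∂D : ℝ) : EReal)

/-- The pair `(ℓ, ℓ')` is a legitimate choice in the search step: both losses belong to the class,
and the empirical gap on the batch `S` exceeds `3ε/4`. -/
def IsWitness {X Y A H : Type*} [Fintype A] [NormedAddCommGroup H] [InnerProductSpace ℝ H]
    [CompleteSpace H] [RKHS ℝ H Y ℝ] {n : ℕ} (𝓛 : Set (A → H)) (β ε : ℝ) (p : X → H)
    (S : Fin n → X × Y) (q : (A → H) × (A → H)) : Prop :=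
  q.1 ∈ 𝓛 ∧ q.2 ∈ 𝓛 ∧ 3 * ε / 4 < empMean S (gap β p q.1 q.2)

/-- The adjustment `d_a = η R₁ v_a / ‖v_a‖`, where `v_a` is the empirical expectation of
`(φ(y) - p(x)) k̃_{ℓ'}(x, a)` over the batch `S` (and `d_a = 0` if `v_a = 0`). -/
def adjustment {X Y A H : Type*} [Fintype A] [NormedAddCommGroup H] [InnerProductSpace ℝ H]
    [CompleteSpace H] [RKHS ℝ H Y ℝ] {n : ℕ} (β R₁ η : ℝ) (p : X → H) (ℓ' : A → H)
    (S : Fin n → X × Y) (a : A) : H :=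
  let v : H := empMean S fun z =>
    smoothRule β (lossEstimator p) ℓ' z.1 a • (featureMap H z.2 - p z.1)
  (η * R₁ / ‖v‖) • v

open Classical in
/-- The metric projection onto the closed ball of radius `R` around the origin of `H`. -/
def projBall {H : Type*} [NormedAddCommGroup H] [InnerProductSpace ℝ H] (R : ℝ) (v : H) : H :=
  if ‖v‖ ≤ R then v else (R / ‖v‖) • v

/-- One iteration: patch `p` by `∑ a, d_a k̃_{ℓ'}(x, a)`, then project onto the ball of radius
`R₂`. -/
def update {X Y A H : Type*} [Fintype A] [NormedAddCommGroup H] [InnerProductSpace ℝ H]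
    [CompleteSpace H] [RKHS ℝ H Y ℝ] {n : ℕ} (β R₁ R₂ η : ℝ) (p : X → H) (ℓ' : A → H)
    (S : Fin n → X × Y) (x : X) : H :=
  projBall R₂
    (p x + ∑ a, smoothRule β (lossEstimator p) ℓ' x a • adjustment β R₁ η p ℓ' S a)

/-- An auditing oracle with batches of size `n`. In round `t` it sees the batches of the rounds
`0, …, t` (which, with the initial predictor, determine the current predictor) and returns a pair of
losses `(ℓ_t, ℓ'_t)`. -/
abbrev Oracle (n : ℕ) (X Y A H : Type*) :=
  ∀ t : ℕ, (Fin (t + 1) → Fin n → X × Y) → (A → H) × (A → H)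

/-- The pair returned by the oracle in round `t` on the stream `S` of batches. -/
def Oracle.query {n : ℕ} {X Y A H : Type*} (aud : Oracle n X Y A H) (S : ℕ → Fin n → X × Y)
    (t : ℕ) : (A → H) × (A → H) :=
  aud t fun s => S s

/-- The predictors `p_0, p_1, …` computed from the stream `S` of batches, batch `t` being used in
round `t` only. -/
def predictorSeq {X Y A H : Type*} [Fintype A] [NormedAddCommGroup H] [InnerProductSpace ℝ H]
    [CompleteSpace H] [RKHS ℝ H Y ℝ] {n : ℕ} (β R₁ R₂ η : ℝ) (p₀ : X → H)
    (aud : Oracle n X Y A H) (S : ℕ → Fin n → X × Y) : ℕ → X → H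
  | 0 => p₀
  | t + 1 =>
    update β R₁ R₂ η (predictorSeq β R₁ R₂ η p₀ aud S t) (aud.query S t).2 (S t)

/-- The oracle is measurable, and whenever the loop test succeeds in a round and a legitimate pair
exists, it returns a legitimate pair. -/
structure IsAuditor {X Y A H : Type*} [MeasurableSpace X] [MeasurableSpace Y] [Fintype A]
    [NormedAddCommGroup H] [InnerProductSpace ℝ H] [CompleteSpace H] [MeasurableSpace H]
    [RKHS ℝ H Y ℝ] {n : ℕ} (D : Measure (X × Y)) (β R₁ R₂ η ε : ℝ) (p₀ : X → H)
    (aud : Oracle n X Y A H) : Prop where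
  measurable : ∀ t, Measurable (aud t)
  finds : ∀ (S : ℕ → Fin n → X × Y) (t : ℕ),
    LoopTest (lossClass A H R₁) D β ε (predictorSeq β R₁ R₂ η p₀ aud S t) →
    (∃ q, IsWitness (lossClass A H R₁) β ε (predictorSeq β R₁ R₂ η p₀ aud S t) (S t) q) →
      IsWitness (lossClass A H R₁) β ε (predictorSeq β R₁ R₂ η p₀ aud S t) (S t) (aud.query S t)

/-- On the stream `S`, the algorithm performs exactly `T` iterations and stops: in each round
`t < T` the loop test succeeds and the search step succeeds, and in round `T` the loop test fails.
The output is then `p_T`, and the batches `0, …, T - 1` have been used. -/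
def HaltsAt {X Y A H : Type*} [MeasurableSpace X] [MeasurableSpace Y] [Fintype A]
    [NormedAddCommGroup H] [InnerProductSpace ℝ H] [CompleteSpace H] [RKHS ℝ H Y ℝ] {n : ℕ}
    (D : Measure (X × Y)) (β R₁ R₂ η ε : ℝ) (p₀ : X → H) (aud : Oracle n X Y A H)
    (S : ℕ → Fin n → X × Y) (T : ℕ) : Prop :=
  (∀ t < T, LoopTest (lossClass A H R₁) D β ε (predictorSeq β R₁ R₂ η p₀ aud S t) ∧
    IsWitness (lossClass A H R₁) β ε (predictorSeq β R₁ R₂ η p₀ aud S t) (S t)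
      (aud.query S t)) ∧
  ¬ LoopTest (lossClass A H R₁) D β ε (predictorSeq β R₁ R₂ η p₀ aud S T)

end

end DimFreeDeCal

/-! The potential is the mean squared error. Fix a batch on which every pair of losses has empirical
gap within `ε / 4` of its expectation. If the loop test succeeds, some pair has empirical gap above
`3ε/4`, so the oracle finds one. For the rule of its `ℓ'`, the loss `bestResponse` maximises the
empirical gap by Cauchy-Schwarz, action by action, so its true gap is at least `ε / 2`. The update
moves along exactly this loss. Expanding the square, with `η = ε / (2 R₁²)` and a projection that
does not increase the distance to `φ(y)`, shows that the error drops by at least `ε² / (4 R₁²)`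
(`HasSmallDeviation.meanSquaredError_update_le`). It starts at most at `4 R₂²` and stays
nonnegative, which bounds the number of rounds. When the loop test fails, the reproducing property
and the symmetry `ℓ ↦ -ℓ` turn this failure into decision calibration.

The sampling bound must not depend on the dimension of `H`. The softmax is Lipschitz, so the gap is
Lipschitz in `2|A|` linear functionals of the pair of losses (`abs_gap_sub_gap_le`). Symmetrization
and contraction replace each summand by a random sign times one randomly chosen, rescaled functional
(`integral_iSup_centered_le`, `meanSup_le_meanSup`). Cauchy-Schwarz removes the losses from the
supremum, and orthogonality of centred independent vectors leaves a bound of order `√n`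
(`meanSup_centered_le`). Bounded differences, in the form of an exponential moment bound
(`integral_exp_supSum_le`), turn the expectation into a tail; a countable dense family reduces all
pairs of losses to finite families.

The predictor of round `t` depends only on earlier batches. Resampling batch `t` in the infinite
product (`infinitePi_le_of_update_le`) therefore transfers the fixed-predictor tail bound to the
adaptive run, and a union bound over the possible rounds concludes. -/

namespace DimFreeDeCal

/-! ### Suprema of sums over i.i.d. samples: concentration and comparison -/

section SupSum

variable {Z W ι : Type*} [MeasurableSpace Z] [MeasurableSpace W]

theorem integrable_of_abs_le {μ : Measure Z} [IsFiniteMeasure μ] {f : Z → ℝ} (hf : Measurable f)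
    {C : ℝ} (hC : ∀ z, |f z| ≤ C) : Integrable f μ :=
  Integrable.of_bound hf.aestronglyMeasurable C (Filter.Eventually.of_forall hC)

theorem abs_integral_le_of_abs_le {μ : Measure Z} [IsProbabilityMeasure μ] {f : Z → ℝ} {C : ℝ}
    (hC : ∀ z, |f z| ≤ C) : |∫ z, f z ∂μ| ≤ C := by
  simpa using norm_integral_le_of_norm_le_const (μ := μ) (f := f) (Filter.Eventually.of_forall hC)

/-- Fubini for the first coordinate of a finite power of a measure. -/
theorem integral_pi_succ {E : Type*} [NormedAddCommGroup E] [NormedSpace ℝ E] (μ : Measure Z)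
    [IsProbabilityMeasure μ] {n : ℕ} (F : (Fin (n + 1) → Z) → E)
    (hF : Integrable F (Measure.pi fun _ => μ)) :
    ∫ z, F z ∂(Measure.pi fun _ : Fin (n + 1) => μ) =
      ∫ z₀, ∫ z, F (Fin.cons z₀ z) ∂(Measure.pi fun _ : Fin n => μ) ∂μ := by
  have e := (measurePreserving_piFinSuccAbove (fun _ : Fin (n + 1) => μ) 0).symm
  have h1 := e.integral_comp' F
  have h2 : Integrable (fun q => F ((MeasurableEquiv.piFinSuccAbove (fun _ => Z) 0).symm q))
      (μ.prod (Measure.pi fun _ : Fin n => μ)) :=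
    (e.integrable_comp_emb (MeasurableEquiv.measurableEmbedding _)).2 hF
  rw [← h1, integral_prod _ h2]
  simp [MeasurableEquiv.piFinSuccAbove, Fin.insertNthEquiv]

variable [Finite ι] [Nonempty ι]

omit [Nonempty ι] in
theorem le_iSup_finite (a : ι → ℝ) (j : ι) : a j ≤ ⨆ j, a j :=
  le_ciSup (Set.finite_range a).bddAbove j

theorem abs_iSup_le {a : ι → ℝ} {C : ℝ} (h : ∀ j, |a j| ≤ C) : |⨆ j, a j| ≤ C := by
  obtain ⟨j, hj⟩ := exists_eq_ciSup_of_finite (f := a)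
  rw [← hj]; exact h j

theorem abs_iSup_sub_iSup_le {a b : ι → ℝ} {C : ℝ} (h : ∀ j, |a j - b j| ≤ C) :
    |(⨆ j, a j) - ⨆ j, b j| ≤ C := by
  rw [abs_le]
  constructor
  · have : ⨆ j, b j ≤ (⨆ j, a j) + C := ciSup_le fun j => by
      have := le_iSup_finite a j
      have := (abs_le.1 (h j)).1
      linarith
    linarith
  · have : ⨆ j, a j ≤ (⨆ j, b j) + C := ciSup_le fun j => by
      have := le_iSup_finite b j
      have := (abs_le.1 (h j)).2
      linarith
    linarith

/-- The supremum over a family of functions `u_j` of the shifted sums `G_j + ∑ i, u_j(z_i)`. -/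
noncomputable def supSum (u : ι → Z → ℝ) (n : ℕ) (G : ι → ℝ) (z : Fin n → Z) : ℝ :=
  ⨆ j, (G j + ∑ i, u j (z i))

/-- The expectation of `supSum` over an i.i.d. sample. -/
noncomputable def meanSup (μ : Measure Z) (u : ι → Z → ℝ) (n : ℕ) (G : ι → ℝ) : ℝ :=
  ∫ z, supSum u n G z ∂(Measure.pi fun _ : Fin n => μ)

omit [MeasurableSpace Z] [Finite ι] [Nonempty ι] in
-- The offset `G` exists for this identity: conditioning on the first sample stays within the same
-- family of suprema, so inductions on `n` close.
theorem supSum_cons (u : ι → Z → ℝ) (n : ℕ) (G : ι → ℝ) (z₀ : Z) (z : Fin n → Z) :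
    supSum u (n + 1) G (Fin.cons z₀ z) = supSum u n (fun j => G j + u j z₀) z := by
  simp [supSum, Fin.sum_univ_succ, add_assoc]

variable {u : ι → Z → ℝ} {c : ℝ}

omit [Nonempty ι] in
theorem measurable_supSum (hu : ∀ j, Measurable (u j)) (n : ℕ) (G : ι → ℝ) :
    Measurable (supSum u n G) := by
  unfold supSum
  refine Measurable.iSup fun j => ?_
  exact measurable_const.add (Finset.measurable_sum _ fun i _ => (hu j).comp (measurable_pi_apply i))

omit [MeasurableSpace Z] in
theorem abs_supSum_le (hc : ∀ j z, |u j z| ≤ c) (n : ℕ) {G : ι → ℝ} {C : ℝ}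
    (hG : ∀ j, |G j| ≤ C) (z : Fin n → Z) : |supSum u n G z| ≤ C + n * c := by
  refine abs_iSup_le fun j => (abs_add_le _ _).trans (add_le_add (hG j) ?_)
  refine (Finset.abs_sum_le_sum_abs _ _).trans ?_
  refine (Finset.sum_le_sum fun i _ => hc j (z i)).trans ?_
  simp

omit [Nonempty ι] in
theorem exists_abs_le (G : ι → ℝ) : ∃ C, ∀ j, |G j| ≤ C := by
  obtain ⟨C, hC⟩ := (Set.finite_range fun j => |G j|).bddAbove
  exact ⟨C, fun j => hC ⟨j, rfl⟩⟩

variable (μ : Measure Z) [IsProbabilityMeasure μ]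

theorem integrable_supSum (hu : ∀ j, Measurable (u j)) (hc : ∀ j z, |u j z| ≤ c) (n : ℕ)
    (G : ι → ℝ) : Integrable (supSum u n G) (Measure.pi fun _ : Fin n => μ) := by
  obtain ⟨C, hC⟩ := exists_abs_le G
  exact integrable_of_abs_le (measurable_supSum hu n G) (abs_supSum_le hc n hC)

theorem meanSup_succ (hu : ∀ j, Measurable (u j)) (hc : ∀ j z, |u j z| ≤ c) (n : ℕ)
    (G : ι → ℝ) : meanSup μ u (n + 1) G = ∫ z₀, meanSup μ u n (fun j => G j + u j z₀) ∂μ := by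
  rw [meanSup, integral_pi_succ μ _ (integrable_supSum μ hu hc _ G)]
  simp only [supSum_cons, meanSup]

theorem abs_meanSup_sub_le (hu : ∀ j, Measurable (u j)) (hc : ∀ j z, |u j z| ≤ c) (n : ℕ)
    {G G' : ι → ℝ} {C : ℝ} (h : ∀ j, |G j - G' j| ≤ C) :
    |meanSup μ u n G - meanSup μ u n G'| ≤ C := by
  rw [meanSup, meanSup, ← integral_sub (integrable_supSum μ hu hc n G)
    (integrable_supSum μ hu hc n G')]
  exact abs_integral_le_of_abs_le fun z => abs_iSup_sub_iSup_le fun j => by simpa using h j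

/-- Serves measurability only: composed with `z₀ ↦ G + u · z₀` it makes the conditional expectation
given the first sample measurable. -/
theorem continuous_meanSup (hu : ∀ j, Measurable (u j)) (hc : ∀ j z, |u j z| ≤ c) (n : ℕ) :
    Continuous (meanSup μ u n) := by
  cases nonempty_fintype ι
  refine (LipschitzWith.of_dist_le_mul (K := 1) fun G G' => ?_).continuous
  rw [Real.dist_eq, NNReal.coe_one, one_mul]
  exact abs_meanSup_sub_le μ hu hc n fun j => by
    simpa [Real.dist_eq] using dist_le_pi_dist G G' j

theorem measurable_meanSup_add (hu : ∀ j, Measurable (u j)) (hc : ∀ j z, |u j z| ≤ c) (n : ℕ)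
    (G : ι → ℝ) : Measurable fun z₀ => meanSup μ u n (fun j => G j + u j z₀) :=
  (continuous_meanSup μ hu hc n).measurable.comp
    (measurable_pi_lambda _ fun j => measurable_const.add (hu j))

theorem integrable_meanSup_add (hu : ∀ j, Measurable (u j)) (hc : ∀ j z, |u j z| ≤ c) (n : ℕ)
    (G : ι → ℝ) : Integrable (fun z₀ => meanSup μ u n (fun j => G j + u j z₀)) μ := by
  obtain ⟨C, hC⟩ := exists_abs_le G
  refine integrable_of_abs_le (measurable_meanSup_add μ hu hc n G) (C := C + c + n * c) fun z => ?_
  exact abs_integral_le_of_abs_le <| abs_supSum_le hc n fun j =>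
    (abs_add_le _ _).trans (add_le_add (hC j) (hc j z))

/-- Hoeffding's lemma for a bounded variable. -/
theorem integral_exp_le_of_abs_sub_le {f : Z → ℝ} (hf : Measurable f) {a : ℝ}
    (h : ∀ z, |f z - a| ≤ c) (r : ℝ) :
    ∫ z, Real.exp (r * f z) ∂μ ≤ Real.exp (r * ∫ z, f z ∂μ + r ^ 2 * c ^ 2 / 2) := by
  have hs := ProbabilityTheory.hasSubgaussianMGF_of_mem_Icc (μ := μ) (X := f) (a := a - c)
    (b := a + c) hf.aemeasurable (Filter.Eventually.of_forall fun z => by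
      have := abs_le.1 (h z)
      constructor <;> linarith)
  have h1 := hs.mgf_le r
  rw [ProbabilityTheory.mgf] at h1
  have h2 : ∀ z, Real.exp (r * f z) =
      Real.exp (r * ∫ z, f z ∂μ) * Real.exp (r * (f z - ∫ z, f z ∂μ)) := fun z => by
    rw [← Real.exp_add]; ring_nf
  simp_rw [h2]
  rw [integral_const_mul, Real.exp_add]
  refine mul_le_mul_of_nonneg_left (h1.trans (Real.exp_le_exp.2 (le_of_eq ?_)))
    (Real.exp_pos _).le
  push_cast
  rw [show a + c - (a - c) = 2 * c by ring, Real.norm_eq_abs, div_pow, sq_abs]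
  ring

/-- The bounded differences method. Given the first sample, the conditional mean of the supremum
stays within `c` of a fixed number, so Hoeffding's lemma charges a factor `exp (r² c² / 2)` per
sample. -/
theorem integral_exp_supSum_le (hu : ∀ j, Measurable (u j)) (hc : ∀ j z, |u j z| ≤ c) (r : ℝ)
    (n : ℕ) (G : ι → ℝ) :
    ∫ z, Real.exp (r * supSum u n G z) ∂(Measure.pi fun _ : Fin n => μ) ≤
      Real.exp (r * meanSup μ u n G + n * (r ^ 2 * c ^ 2 / 2)) := by
  have hint : ∀ n G, Integrable (fun z => Real.exp (r * supSum u n G z))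
      (Measure.pi fun _ : Fin n => μ) := fun n G => by
    obtain ⟨C, hC⟩ := exists_abs_le G
    refine integrable_of_abs_le (Real.measurable_exp.comp
      ((measurable_supSum hu n G).const_mul r)) (C := Real.exp (|r| * (C + n * c))) fun z => ?_
    rw [Real.abs_exp]
    refine Real.exp_le_exp.2 ((le_abs_self _).trans ?_)
    rw [abs_mul]
    exact mul_le_mul_of_nonneg_left (abs_supSum_le hc n hC z) (abs_nonneg _)
  induction n generalizing G with
  | zero =>
    simp only [meanSup, supSum, Finset.univ_eq_empty, Finset.sum_empty, integral_const]
    simp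
  | succ n ih =>
    rw [integral_pi_succ μ _ (hint _ G)]
    simp only [supSum_cons]
    have hle : ∀ z₀, |meanSup μ u n (fun j => G j + u j z₀) - meanSup μ u n G| ≤ c := fun z₀ =>
      abs_meanSup_sub_le μ hu hc n fun j => by simpa using hc j z₀
    calc _ ≤ ∫ z₀, Real.exp (r * meanSup μ u n (fun j => G j + u j z₀)) *
            Real.exp (n * (r ^ 2 * c ^ 2 / 2)) ∂μ := by
          refine integral_mono_of_nonneg
            (Filter.Eventually.of_forall fun z₀ => integral_nonneg fun z => (Real.exp_pos _).le) ?_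
            (Filter.Eventually.of_forall fun z₀ => ?_)
          · refine (integrable_of_abs_le (Real.measurable_exp.comp
              ((measurable_meanSup_add μ hu hc n G).const_mul r))
              (C := Real.exp (|r| * (|meanSup μ u n G| + c))) fun z => ?_).mul_const _
            simp only [Function.comp]
            rw [Real.abs_exp]
            refine Real.exp_le_exp.2 ((le_abs_self _).trans ?_)
            rw [abs_mul]
            refine mul_le_mul_of_nonneg_left ?_ (abs_nonneg _)
            have := abs_sub_abs_le_abs_sub (meanSup μ u n fun j => G j + u j z) (meanSup μ u n G)
            linarith [hle z]
          · simpa only [← Real.exp_add] using ih fun j => G j + u j z₀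
      _ ≤ Real.exp (r * meanSup μ u (n + 1) G + r ^ 2 * c ^ 2 / 2) *
            Real.exp (n * (r ^ 2 * c ^ 2 / 2)) := by
          rw [integral_mul_const, meanSup_succ μ hu hc]
          exact mul_le_mul_of_nonneg_right (integral_exp_le_of_abs_sub_le μ
            (measurable_meanSup_add μ hu hc n G) hle r) (Real.exp_pos _).le
      _ = _ := by
          rw [← Real.exp_add]
          push_cast
          ring_nf

theorem integrable_supSum_add {V : Type*} [MeasurableSpace V] (m : Measure V)
    [IsProbabilityMeasure m] {v : ι → V → ℝ} {b : ℝ} (hu : ∀ j, Measurable (u j))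
    (hc : ∀ j z, |u j z| ≤ c) (hv : ∀ j, Measurable (v j)) (hb : ∀ j z, |v j z| ≤ b) (n : ℕ)
    (G : ι → ℝ) :
    Integrable (fun q : V × (Fin n → Z) => supSum u n (fun j => G j + v j q.1) q.2)
      (m.prod (Measure.pi fun _ : Fin n => μ)) := by
  obtain ⟨C, hC⟩ := exists_abs_le G
  refine integrable_of_abs_le (C := C + b + n * c) ?_ fun z => ?_
  · refine Measurable.iSup fun j => ?_
    exact (measurable_const.add ((hv j).comp measurable_fst)).add
      (Finset.measurable_sum _ fun i _ =>
        (hu j).comp ((measurable_pi_apply i).comp measurable_snd))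
  · exact abs_supSum_le hc n (fun j =>
      (abs_add_le _ _).trans (add_le_add (hC j) (hb j z.1))) z.2

theorem integral_meanSup_add {V : Type*} [MeasurableSpace V] (m : Measure V)
    [IsProbabilityMeasure m] {v : ι → V → ℝ} {b : ℝ} (hu : ∀ j, Measurable (u j))
    (hc : ∀ j z, |u j z| ≤ c) (hv : ∀ j, Measurable (v j)) (hb : ∀ j z, |v j z| ≤ b) (n : ℕ)
    (G : ι → ℝ) :
    ∫ z₀, meanSup μ u n (fun j => G j + v j z₀) ∂m =
      ∫ z, ∫ z₀, ⨆ j, ((G j + ∑ i, u j (z i)) + v j z₀) ∂m ∂(Measure.pi fun _ : Fin n => μ) := by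
  simp only [meanSup]
  rw [integral_integral_swap (integrable_supSum_add μ m hu hc hv hb n G)]
  simp only [supSum, add_right_comm]

/-- Comparison of the expected suprema of two families, from the comparison for one summand. -/
theorem meanSup_le_meanSup {ν : Measure W} [IsProbabilityMeasure ν] {w : ι → W → ℝ} {c' : ℝ}
    (hu : ∀ j, Measurable (u j)) (hc : ∀ j z, |u j z| ≤ c)
    (hw : ∀ j, Measurable (w j)) (hc' : ∀ j z, |w j z| ≤ c')
    (h : ∀ G : ι → ℝ, ∫ z, ⨆ j, (G j + u j z) ∂μ ≤ ∫ z, ⨆ j, (G j + w j z) ∂ν)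
    (n : ℕ) (G : ι → ℝ) : meanSup μ u n G ≤ meanSup ν w n G := by
  induction n generalizing G with
  | zero =>
    simp only [meanSup, supSum, Finset.univ_eq_empty, Finset.sum_empty, integral_const]
    simp
  | succ n ih =>
    rw [meanSup_succ μ hu hc, meanSup_succ ν hw hc']
    -- The induction hypothesis exchanges all summands but the first. Fubini then puts the first one
    -- innermost, where the other summands are constants absorbed into the offset and `h` applies.
    have hi := integrable_supSum_add ν μ hw hc' hu hc n G
    refine (integral_mono (integrable_meanSup_add μ hu hc n G) hi.integral_prod_left
      fun z => ih _).trans ?_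
    have hi' := integrable_supSum_add ν ν hw hc' hw hc' n G
    change ∫ z₀, meanSup ν w n (fun j => G j + u j z₀) ∂μ ≤ _
    rw [integral_meanSup_add ν μ hw hc' hu hc, integral_meanSup_add ν ν hw hc' hw hc']
    refine integral_mono (hi.integral_prod_right.congr (Filter.Eventually.of_forall fun z => ?_))
      (hi'.integral_prod_right.congr (Filter.Eventually.of_forall fun z => ?_)) fun z => h _
    all_goals simp only [supSum, add_right_comm]

end SupSum

/-! ### Symmetrization and vector contraction -/

section Symmetrization

variable {Z ι K : Type*} [Finite ι] [Nonempty ι] [Fintype K] [Nonempty K]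

/-- The sign `1` or `-1` encoded by a Boolean. -/
def boolSign (s : Bool) : ℝ := if s then 1 else -1

/-- Contraction: a random sign in front of a function that is `1`-Lipschitz in finitely many
coordinates may be replaced by a random sign in front of a random rescaled coordinate. -/
theorem contraction_step (G f : ι → ℝ) (g : ι → K → ℝ)
    (h : ∀ j j', |f j - f j'| ≤ ∑ k, |g j k - g j' k|) :
    ((⨆ j, (G j + 2 * f j)) + ⨆ j, (G j - 2 * f j)) / 2 ≤
      ∑ q : K × Bool, ((Fintype.card (K × Bool) : ℝ))⁻¹ *
        ⨆ j, (G j + 2 * Fintype.card K * boolSign q.2 * g j q.1) := by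
  obtain ⟨j, hj⟩ := exists_eq_ciSup_of_finite (f := fun j => G j + 2 * f j)
  obtain ⟨j', hj'⟩ := exists_eq_ciSup_of_finite (f := fun j => G j - 2 * f j)
  rw [← hj, ← hj', ← Finset.mul_sum, Fintype.sum_prod_type]
  simp only [Fintype.sum_bool, boolSign, Fintype.card_prod, Fintype.card_bool, if_true,
    Bool.false_eq_true, if_false]
  have hd : (0 : ℝ) < Fintype.card K := by exact_mod_cast Fintype.card_pos
  -- Both signs are available for coordinate `k`, so `j` and `j'` can be assigned to the two suprema
  -- in whichever order produces the absolute value. Averaging over `k` then cancels the factor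
  -- `|K|`.
  have key : ∀ k, G j + G j' + 2 * Fintype.card K * |g j k - g j' k| ≤
      (⨆ j, (G j + 2 * Fintype.card K * 1 * g j k)) +
        ⨆ j, (G j + 2 * Fintype.card K * (-1) * g j k) := fun k => by
    have p := le_iSup_finite fun j => G j + 2 * Fintype.card K * 1 * g j k
    have q := le_iSup_finite fun j => G j + 2 * Fintype.card K * (-1) * g j k
    rcases abs_cases (g j k - g j' k) with ⟨e, -⟩ | ⟨e, -⟩ <;> rw [e]
    · linarith [p j, q j']
    · linarith [p j', q j]
  have hsum := Finset.sum_le_sum fun k (_ : k ∈ Finset.univ) => key k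
  rw [Finset.sum_add_distrib, ← Finset.mul_sum, Finset.sum_const, Finset.card_univ,
    nsmul_eq_mul] at hsum
  have h1 := (le_abs_self _).trans (h j j')
  rw [← div_eq_inv_mul, le_div_iff₀ (by push_cast; positivity)]
  push_cast
  nlinarith [mul_le_mul_of_nonneg_left h1 hd.le]

variable [MeasurableSpace Z] [MeasurableSpace K] [MeasurableSingletonClass K]

/-- The law of a uniformly random coordinate together with an independent random sign. -/
noncomputable def signMeasure (K : Type*) [Fintype K] [Nonempty K] [MeasurableSpace K] :
    Measure (K × Bool) :=
  (PMF.uniformOfFintype (K × Bool)).toMeasure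

instance : IsProbabilityMeasure (signMeasure K) := by
  unfold signMeasure; infer_instance

theorem integral_signMeasure {E : Type*} [NormedAddCommGroup E] [NormedSpace ℝ E] [CompleteSpace E]
    (f : K × Bool → E) :
    ∫ q, f q ∂(signMeasure K) = ∑ q, ((Fintype.card (K × Bool) : ℝ))⁻¹ • f q := by
  rw [signMeasure, PMF.integral_eq_sum]
  simp

variable (μ : Measure Z) [IsProbabilityMeasure μ] {f : ι → Z → ℝ} {g : ι → K → Z → ℝ} {b c : ℝ}

/-- No ghost sample is needed: `G + 𝔼f - f` is the average of `G + 2𝔼f` and `G - 2f`, and Jensen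
moves the expectation in the first out of the supremum. `contraction_step` then applies at each `z`.
-/
theorem integral_iSup_centered_le (hf : ∀ j, Measurable (f j)) (hb : ∀ j z, |f j z| ≤ b)
    (hg : ∀ j k, Measurable (g j k)) (hc : ∀ j k z, |g j k z| ≤ c)
    (h : ∀ j j' z, |f j z - f j' z| ≤ ∑ k, |g j k z - g j' k z|) (G : ι → ℝ) :
    ∫ z, ⨆ j, (G j + ((∫ z', f j z' ∂μ) - f j z)) ∂μ ≤
      ∫ q, ⨆ j, (G j + 2 * Fintype.card K * boolSign q.2.2 * g j q.2.1 q.1)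
        ∂(μ.prod (signMeasure K)) := by
  obtain ⟨C, hC⟩ := exists_abs_le G
  have hsign : ∀ s, |boolSign s| = 1 := fun s => by cases s <;> simp [boolSign]
  have hi : ∀ r : ℝ, Integrable (fun z => ⨆ j, (G j + r * f j z)) μ := fun r =>
    integrable_of_abs_le (Measurable.iSup fun j => measurable_const.add ((hf j).const_mul r))
      (C := C + |r| * b) fun z => abs_iSup_le fun j => (abs_add_le _ _).trans <|
        add_le_add (hC j) <| by
          rw [abs_mul]; exact mul_le_mul_of_nonneg_left (hb j z) (abs_nonneg _)
  have hfi : ∀ j, Integrable (f j) μ := fun j => integrable_of_abs_le (hf j) (hb j)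
  have hmean : ⨆ j, (G j + 2 * ∫ z', f j z' ∂μ) ≤ ∫ z, ⨆ j, (G j + 2 * f j z) ∂μ := by
    refine ciSup_le fun j => ?_
    have : G j + 2 * ∫ z', f j z' ∂μ = ∫ z', (G j + 2 * f j z') ∂μ := by
      rw [integral_add (integrable_const _) ((hfi j).const_mul 2), integral_const_mul]; simp
    rw [this]
    exact integral_mono ((integrable_const _).add ((hfi j).const_mul 2)) (hi 2) fun z =>
      le_iSup_finite (fun j => G j + 2 * f j z) j
  have hm2 : ∀ z, (⨆ j, (G j - 2 * f j z)) = ⨆ j, (G j + (-2) * f j z) := fun z => by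
    simp only [neg_mul, sub_eq_add_neg]
  have step1 : ∫ z, ⨆ j, (G j + ((∫ z', f j z' ∂μ) - f j z)) ∂μ ≤
      ∫ z, ((⨆ j, (G j + 2 * ∫ z', f j z' ∂μ)) + ⨆ j, (G j - 2 * f j z)) / 2 ∂μ := by
    simp only [hm2]
    refine integral_mono ?_ (((integrable_const _).add (hi (-2))).div_const 2) fun z => ?_
    · refine integrable_of_abs_le (Measurable.iSup fun j => measurable_const.add
        (measurable_const.sub (hf j))) (C := C + (b + b)) fun z => abs_iSup_le fun j =>
          (abs_add_le _ _).trans <| add_le_add (hC j) <| (abs_sub _ _).trans <|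
            add_le_add (abs_integral_le_of_abs_le (hb j)) (hb j z)
    · refine ciSup_le fun j => ?_
      have h1 := le_iSup_finite (fun j => G j + 2 * ∫ z', f j z' ∂μ) j
      have h2 := le_iSup_finite (fun j => G j + (-2) * f j z) j
      dsimp only at h1 h2 ⊢
      linarith
  have step2 : ∫ z, ((⨆ j, (G j + 2 * ∫ z', f j z' ∂μ)) + ⨆ j, (G j - 2 * f j z)) / 2 ∂μ ≤
      ∫ z, ((⨆ j, (G j + 2 * f j z)) + ⨆ j, (G j - 2 * f j z)) / 2 ∂μ := by
    simp only [hm2]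
    rw [integral_div, integral_div, integral_add (integrable_const _) (hi (-2)),
      integral_add (hi 2) (hi (-2))]
    simp only [integral_const, probReal_univ, one_smul]
    linarith
  have hint : Integrable (fun q : Z × K × Bool =>
      ⨆ j, (G j + 2 * Fintype.card K * boolSign q.2.2 * g j q.2.1 q.1))
      (μ.prod (signMeasure K)) := by
    refine integrable_of_abs_le (C := C + 2 * Fintype.card K * c) ?_ fun q => ?_
    · refine Measurable.iSup fun j => ?_
      exact measurable_from_prod_countable_left fun q =>
        measurable_const.add ((hg j q.1).const_mul (2 * Fintype.card K * boolSign q.2))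
    · refine abs_iSup_le fun j => (abs_add_le _ _).trans <| add_le_add (hC j) ?_
      rw [abs_mul, abs_mul, hsign, mul_one, abs_of_nonneg (by positivity)]
      exact mul_le_mul_of_nonneg_left (hc _ _ _) (by positivity)
  refine (step1.trans step2).trans ?_
  rw [integral_prod _ hint]
  refine integral_mono ?_ hint.integral_prod_left fun z => ?_
  · simp only [hm2]
    exact ((hi 2).add (hi (-2))).div_const 2
  · dsimp only
    rw [integral_signMeasure]
    simpa only [smul_eq_mul] using
      contraction_step G (fun j => f j z) (fun j k => g j k z) fun j j' => h j j' z

end Symmetrization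

/-! ### Second moments of sums of independent vectors in a Hilbert space -/

section SecondMoment

variable {W H : Type*} [MeasurableSpace W] [NormedAddCommGroup H] [InnerProductSpace ℝ H]
  [CompleteSpace H]

omit [MeasurableSpace W] [InnerProductSpace ℝ H] [CompleteSpace H] in
theorem norm_add_sum_le {ξ : W → H} {B : ℝ} (hB : ∀ w, ‖ξ w‖ ≤ B) (n : ℕ) (h : H)
    (w : Fin n → W) : ‖h + ∑ i, ξ (w i)‖ ≤ ‖h‖ + n * B := by
  refine (norm_add_le _ _).trans (add_le_add le_rfl ((norm_sum_le _ _).trans ?_))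
  exact (Finset.sum_le_sum fun i _ => hB (w i)).trans (by simp)

omit [InnerProductSpace ℝ H] [CompleteSpace H] in
theorem integrable_norm_sum_sq (ν : Measure W) [IsProbabilityMeasure ν] {ξ : W → H} {B : ℝ}
    (hξ : StronglyMeasurable ξ) (hB : ∀ w, ‖ξ w‖ ≤ B) (n : ℕ) (h : H) :
    Integrable (fun w => ‖h + ∑ i, ξ (w i)‖ ^ 2) (Measure.pi fun _ : Fin n => ν) := by
  have hm : StronglyMeasurable fun w : Fin n → W => h + ∑ i, ξ (w i) :=
    stronglyMeasurable_const.add (Finset.stronglyMeasurable_fun_sum _ fun i _ =>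
      hξ.comp_measurable (measurable_pi_apply i))
  refine integrable_of_abs_le (hm.norm.measurable.pow_const 2) (C := (‖h‖ + n * B) ^ 2) fun w => ?_
  rw [abs_of_nonneg (by positivity)]
  exact pow_le_pow_left₀ (norm_nonneg _) (norm_add_sum_le hB n h w) 2

/-- The second moment of a sum of centred independent vectors. -/
theorem integral_norm_sum_sq_le (ν : Measure W) [IsProbabilityMeasure ν] {ξ : W → H} {B : ℝ}
    (hξ : StronglyMeasurable ξ) (hB : ∀ w, ‖ξ w‖ ≤ B) (h0 : ∫ w, ξ w ∂ν = 0) (n : ℕ) (h : H) :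
    ∫ w, ‖h + ∑ i, ξ (w i)‖ ^ 2 ∂(Measure.pi fun _ : Fin n => ν) ≤ ‖h‖ ^ 2 + n * B ^ 2 := by
  have hi : Integrable ξ ν :=
    Integrable.of_bound hξ.aestronglyMeasurable B (Filter.Eventually.of_forall hB)
  have hsq : ∀ w, ‖ξ w‖ ^ 2 ≤ B ^ 2 := fun w => pow_le_pow_left₀ (norm_nonneg _) (hB w) 2
  have hi2 : Integrable (fun w => ‖ξ w‖ ^ 2) ν :=
    integrable_of_abs_le (hξ.norm.measurable.pow_const 2) (C := B ^ 2) fun w => by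
      rw [abs_of_nonneg (by positivity)]; exact hsq w
  induction n generalizing h with
  | zero => simp
  | succ n ih =>
    rw [integral_pi_succ ν _ (integrable_norm_sum_sq ν hξ hB _ h)]
    simp only [Fin.sum_univ_succ, Fin.cons_zero, Fin.cons_succ, ← add_assoc]
    have hin : Integrable (fun w => ‖h‖ ^ 2 + 2 * inner ℝ h (ξ w)) ν :=
      (integrable_const _).add ((hi.const_inner h).const_mul 2)
    have hin2 : Integrable (fun w => ‖h‖ ^ 2 + 2 * inner ℝ h (ξ w) + ‖ξ w‖ ^ 2) ν := hin.add hi2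
    -- The vector already drawn joins the offset `h`; the cross term integrates to zero because `ξ`
    -- is centred.
    have hstep : ∀ w, ‖h + ξ w‖ ^ 2 = ‖h‖ ^ 2 + 2 * inner ℝ h (ξ w) + ‖ξ w‖ ^ 2 :=
      fun w => norm_add_sq_real h (ξ w)
    have hi3 : Integrable (fun w => ‖h + ξ w‖ ^ 2 + n * B ^ 2) ν := by
      simp only [hstep]
      exact hin2.add (integrable_const _)
    refine (integral_mono_of_nonneg
      (Filter.Eventually.of_forall fun w => integral_nonneg fun _ => by positivity) hi3
      (Filter.Eventually.of_forall fun w => ih (h + ξ w))).trans ?_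
    simp only [hstep]
    have e1 : ∫ w, ‖ξ w‖ ^ 2 ∂ν ≤ B ^ 2 := by
      simpa using integral_mono hi2 (integrable_const (B ^ 2)) hsq
    rw [integral_add hin2 (integrable_const _), integral_add hin hi2,
      integral_add (integrable_const _) ((hi.const_inner h).const_mul 2),
      integral_const_mul, integral_inner hi, h0]
    simp only [integral_const, probReal_univ, one_smul, inner_zero_right, mul_zero, add_zero]
    push_cast
    linarith

theorem integral_norm_sum_le (ν : Measure W) [IsProbabilityMeasure ν] {ξ : W → H} {B : ℝ}
    (hξ : StronglyMeasurable ξ) (hB : ∀ w, ‖ξ w‖ ≤ B) (h0 : ∫ w, ξ w ∂ν = 0) (n : ℕ) :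
    ∫ w, ‖∑ i, ξ (w i)‖ ∂(Measure.pi fun _ : Fin n => ν) ≤ √n * B := by
  have h1 := integral_norm_sum_sq_le ν hξ hB h0 n 0
  have h2 := integrable_norm_sum_sq ν hξ hB n 0
  simp only [zero_add, norm_zero, ne_eq, OfNat.ofNat_ne_zero, not_false_eq_true, zero_pow] at h1 h2
  have hm : StronglyMeasurable fun w : Fin n → W => ∑ i, ξ (w i) :=
    Finset.stronglyMeasurable_fun_sum _ fun i _ => hξ.comp_measurable (measurable_pi_apply i)
  have hint : Integrable (fun w => ‖∑ i, ξ (w i)‖) (Measure.pi fun _ : Fin n => ν) :=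
    integrable_of_abs_le hm.norm.measurable (C := n * B) fun w => by
      simpa using norm_add_sum_le hB n 0 w
  have hB0 : 0 ≤ B := by
    obtain ⟨w⟩ := nonempty_of_isProbabilityMeasure ν
    exact (norm_nonneg _).trans (hB w)
  have hJ : (∫ w, ‖∑ i, ξ (w i)‖ ∂(Measure.pi fun _ : Fin n => ν)) ^ 2 ≤
      ∫ w, ‖∑ i, ξ (w i)‖ ^ 2 ∂(Measure.pi fun _ : Fin n => ν) :=
    (convexOn_pow 2).map_integral_le (continuous_pow 2).continuousOn isClosed_Ici
      (Filter.Eventually.of_forall fun w => norm_nonneg _) hint h2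
  refine abs_le_of_sq_le_sq' (b := √n * B) ?_ (by positivity) |>.2
  rw [mul_pow, Real.sq_sqrt (Nat.cast_nonneg n)]
  exact hJ.trans h1

end SecondMoment

/-! ### Dimension-free uniform deviation bounds -/

section UniformDeviation

variable {Z H K : Type*} [MeasurableSpace Z] [NormedAddCommGroup H] [InnerProductSpace ℝ H]
  [CompleteSpace H] [MeasurableSpace H] [BorelSpace H] [SecondCountableTopology H] [Fintype K]
  [Nonempty K] (μ : Measure Z) [IsProbabilityMeasure μ] {b R ε : ℝ} {V : K → Z → H} {B : K → ℝ}

section Vector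

variable [MeasurableSpace K] [MeasurableSingletonClass K]

open Classical in
/-- The vector `2 |K| s V_k(z)` if the random coordinate is `k`, and `0` otherwise. -/
noncomputable def signedFeature (V : K → Z → H) (k : K) (q : Z × K × Bool) : H :=
  if q.2.1 = k then (2 * Fintype.card K * boolSign q.2.2) • V k q.1 else 0

omit [CompleteSpace H] [Nonempty K] in
theorem stronglyMeasurable_signedFeature (hV : ∀ k, Measurable (V k)) (k : K) :
    StronglyMeasurable (signedFeature V k) := by
  refine Measurable.stronglyMeasurable (measurable_from_prod_countable_left fun q => ?_)
  by_cases h : q.1 = k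
  · simp only [signedFeature, h, if_true]
    exact (hV k).const_smul _
  · simp only [signedFeature, h, if_false]
    exact measurable_const

omit [MeasurableSpace Z] [CompleteSpace H] [MeasurableSpace H] [BorelSpace H]
  [SecondCountableTopology H] [Nonempty K] [MeasurableSpace K] [MeasurableSingletonClass K] in
theorem norm_signedFeature_le (hB : ∀ k z, ‖V k z‖ ≤ B k) (k : K) (q : Z × K × Bool) :
    ‖signedFeature V k q‖ ≤ 2 * Fintype.card K * B k := by
  have h0 : 0 ≤ B k := (norm_nonneg _).trans (hB k q.1)
  have hs : |boolSign q.2.2| = 1 := by cases q.2.2 <;> simp [boolSign]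
  unfold signedFeature
  split_ifs
  · rw [norm_smul, Real.norm_eq_abs, abs_mul, hs, mul_one, abs_of_nonneg (by positivity)]
    exact mul_le_mul_of_nonneg_left (hB k _) (by positivity)
  · rw [norm_zero]; positivity

/-- The two signs cancel for each fixed `z` and coordinate, so the `V k` themselves need not be
centred. -/
theorem integral_signedFeature (hV : ∀ k, Measurable (V k)) (hB : ∀ k z, ‖V k z‖ ≤ B k) (k : K) :
    ∫ q, signedFeature V k q ∂(μ.prod (signMeasure K)) = 0 := by
  rw [integral_prod _ (Integrable.of_bound
    (stronglyMeasurable_signedFeature hV k).aestronglyMeasurable _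
    (Filter.Eventually.of_forall (norm_signedFeature_le hB k)))]
  refine (integral_congr_ae (Filter.Eventually.of_forall fun z => ?_)).trans (integral_zero Z H)
  rw [integral_signMeasure, Fintype.sum_prod_type]
  refine Finset.sum_eq_zero fun k' _ => ?_
  by_cases h : k' = k <;> simp [signedFeature, boolSign, h]

omit [MeasurableSpace Z] [CompleteSpace H] [MeasurableSpace H] [BorelSpace H]
  [SecondCountableTopology H] [Nonempty K] [MeasurableSpace K] [MeasurableSingletonClass K] in
-- Here the dimension disappears: after sorting by coordinate, Cauchy-Schwarz gives a bound free of
-- `l`, so the supremum over the class costs nothing more.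
theorem sum_signed_inner_le (l : K → H) (hl : ∀ k, ‖l k‖ ≤ R) {n : ℕ}
    (w : Fin n → Z × K × Bool) :
    ∑ i, 2 * Fintype.card K * boolSign (w i).2.2 * inner ℝ (l (w i).2.1) (V (w i).2.1 (w i).1) ≤
      R * ∑ k, ‖∑ i, signedFeature V k (w i)‖ := by
  have e : ∀ i, 2 * Fintype.card K * boolSign (w i).2.2 *
      inner ℝ (l (w i).2.1) (V (w i).2.1 (w i).1) =
      ∑ k, inner ℝ (l k) (signedFeature V k (w i)) := fun i => by
    rw [Finset.sum_eq_single (w i).2.1]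
    · simp [signedFeature, inner_smul_right]
    · intro k _ hk
      simp [signedFeature, hk.symm]
    · simp
  simp only [e]
  rw [Finset.sum_comm, Finset.mul_sum]
  refine Finset.sum_le_sum fun k _ => ?_
  rw [← inner_sum]
  exact (real_inner_le_norm _ _).trans (mul_le_mul_of_nonneg_right (hl k) (norm_nonneg _))

variable {ι : Type*} [Finite ι] [Nonempty ι] {f : ι → Z → ℝ} {l : ι → K → H}

/-- Dimension-free bound on the expected uniform deviation of a class of functions that is
Lipschitz in finitely many bounded linear functionals of bounded features. -/
theorem meanSup_centered_le (hf : ∀ j, Measurable (f j)) (hb : ∀ j z, |f j z| ≤ b)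
    (hV : ∀ k, Measurable (V k)) (hB : ∀ k z, ‖V k z‖ ≤ B k) (hl : ∀ j k, ‖l j k‖ ≤ R)
    (h : ∀ j j' z, |f j z - f j' z| ≤ ∑ k, |inner ℝ (l j k) (V k z) - inner ℝ (l j' k) (V k z)|)
    (n : ℕ) :
    meanSup μ (fun j z => (∫ z', f j z' ∂μ) - f j z) n 0 ≤
      √n * (2 * Fintype.card K * R * ∑ k, B k) := by
  have hZ : Nonempty Z := nonempty_of_isProbabilityMeasure μ
  have hR : 0 ≤ R := (norm_nonneg _).trans (hl (Classical.arbitrary ι) (Classical.arbitrary K))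
  have hB0 : ∀ k, 0 ≤ B k := fun k => (norm_nonneg _).trans (hB k (Classical.arbitrary Z))
  have hg : ∀ j k, Measurable fun z => inner ℝ (l j k) (V k z) := fun j k =>
    measurable_const.inner (hV k)
  have hgc : ∀ j k z, |inner ℝ (l j k) (V k z)| ≤ R * ∑ k, B k := fun j k z =>
    (abs_real_inner_le_norm _ _).trans (mul_le_mul (hl j k)
      ((hB k z).trans (Finset.single_le_sum (f := B) (fun k _ => hB0 k) (Finset.mem_univ k)))
      (norm_nonneg _) hR)
  have hsign : ∀ s, |boolSign s| = 1 := fun s => by cases s <;> simp [boolSign]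
  have hcmp := meanSup_le_meanSup μ (ν := μ.prod (signMeasure K))
    (u := fun j z => (∫ z', f j z' ∂μ) - f j z)
    (w := fun j q => 2 * Fintype.card K * boolSign q.2.2 * inner ℝ (l j q.2.1) (V q.2.1 q.1))
    (c := b + b) (c' := 2 * Fintype.card K * (R * ∑ k, B k))
    (fun j => measurable_const.sub (hf j))
    (fun j z => (abs_sub _ _).trans (add_le_add (abs_integral_le_of_abs_le (hb j)) (hb j z)))
    (fun j => measurable_from_prod_countable_left fun q =>
      (hg j q.1).const_mul (2 * Fintype.card K * boolSign q.2))
    (fun j q => by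
      rw [abs_mul, abs_mul, hsign, mul_one, abs_of_nonneg (by positivity)]
      exact mul_le_mul_of_nonneg_left (hgc _ _ _) (by positivity))
    (integral_iSup_centered_le μ hf hb hg hgc h) n 0
  refine hcmp.trans ?_
  have hint : ∀ k, Integrable (fun w => ‖∑ i, signedFeature V k (w i)‖)
      (Measure.pi fun _ : Fin n => μ.prod (signMeasure K)) := fun k =>
    integrable_of_abs_le (Finset.stronglyMeasurable_fun_sum _ fun i _ =>
      (stronglyMeasurable_signedFeature hV k).comp_measurable (measurable_pi_apply i)).norm.measurable
      (C := n * (2 * Fintype.card K * B k)) fun w => by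
      simpa using norm_add_sum_le (norm_signedFeature_le hB k) n 0 w
  calc _ ≤ ∫ w, R * ∑ k, ‖∑ i, signedFeature V k (w i)‖
        ∂(Measure.pi fun _ : Fin n => μ.prod (signMeasure K)) := by
        refine integral_mono (integrable_supSum _ (c := 2 * Fintype.card K * (R * ∑ k, B k))
          (fun j => measurable_from_prod_countable_left fun q =>
            (hg j q.1).const_mul (2 * Fintype.card K * boolSign q.2))
          (fun j q => by
            rw [abs_mul, abs_mul, hsign, mul_one, abs_of_nonneg (by positivity)]
            exact mul_le_mul_of_nonneg_left (hgc _ _ _) (by positivity)) n 0)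
          ((integrable_finsetSum _ fun k _ => hint k).const_mul R) fun w => ?_
        refine ciSup_le fun j => ?_
        rw [Pi.zero_apply, zero_add]
        exact sum_signed_inner_le (l j) (hl j) w
    _ ≤ R * ∑ k, √n * (2 * Fintype.card K * B k) := by
        rw [integral_const_mul, integral_finsetSum _ fun k _ => hint k]
        refine mul_le_mul_of_nonneg_left (Finset.sum_le_sum fun k _ => ?_) hR
        exact integral_norm_sum_le _ (stronglyMeasurable_signedFeature hV k)
          (norm_signedFeature_le hB k) (integral_signedFeature μ hV hB k) n
    _ = _ := by
        rw [← Finset.mul_sum, ← Finset.mul_sum]; ring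

end Vector

/-- Tail bound for the uniform deviation over a finite family. -/
theorem measure_exists_deviation_le_of_finite {ι : Type*} [Finite ι] [Nonempty ι]
    {f : ι → Z → ℝ} {l : ι → K → H} (hb0 : 0 < b) (hε : 0 < ε)
    (hf : ∀ j, Measurable (f j)) (hb : ∀ j z, |f j z| ≤ b)
    (hV : ∀ k, Measurable (V k)) (hB : ∀ k z, ‖V k z‖ ≤ B k) (hl : ∀ j k, ‖l j k‖ ≤ R)
    (h : ∀ j j' z, |f j z - f j' z| ≤ ∑ k, |inner ℝ (l j k) (V k z) - inner ℝ (l j' k) (V k z)|)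
    {n : ℕ} (hn : 16 * Fintype.card K * R * ∑ k, B k ≤ √n * ε) :
    (Measure.pi fun _ : Fin n => μ)
        {S | ∃ j, n * ε / 4 < ∑ i, ((∫ z, f j z ∂μ) - f j (S i))} ≤
      ENNReal.ofReal (Real.exp (-(n * ε ^ 2 / (512 * b ^ 2)))) := by
  -- The discrete σ-algebra on the finite set `K`, required by `signMeasure`.
  let _ : MeasurableSpace K := ⊤
  set u : ι → Z → ℝ := fun j z => (∫ z', f j z' ∂μ) - f j z with hu
  have hum : ∀ j, Measurable (u j) := fun j => measurable_const.sub (hf j)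
  have huc : ∀ j z, |u j z| ≤ 2 * b := fun j z => by
    rw [two_mul]
    exact (abs_sub _ _).trans (add_le_add (abs_integral_le_of_abs_le (hb j)) (hb j z))
  have hmean : meanSup μ u n 0 ≤ n * ε / 8 := by
    refine (meanSup_centered_le μ hf hb hV hB hl h n).trans ?_
    have hs : √(n : ℝ) * √n = n := Real.mul_self_sqrt (Nat.cast_nonneg n)
    have := mul_le_mul_of_nonneg_left hn (Real.sqrt_nonneg (n : ℝ))
    rw [show √(n : ℝ) * (√n * ε) = √n * √n * ε by ring, hs] at this
    linarith
  -- The minimiser of `-r n ε / 8 + 2 n r² b²`, the exponent left when the mean is at most `n ε /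
  -- 8`, the threshold is `n ε / 4` and the summands are bounded by `2b`.
  set r : ℝ := ε / (32 * b ^ 2) with hr
  have hr0 : 0 < r := by positivity
  have hmgf := integral_exp_supSum_le μ hum huc r n 0
  have hint : Integrable (fun z => Real.exp (r * supSum u n 0 z))
      (Measure.pi fun _ : Fin n => μ) := by
    refine integrable_of_abs_le (Real.measurable_exp.comp
      ((measurable_supSum hum n 0).const_mul r))
      (C := Real.exp (r * (0 + n * (2 * b)))) fun z => ?_
    simp only [Real.abs_exp]
    refine Real.exp_le_exp.2 (mul_le_mul_of_nonneg_left ((le_abs_self _).trans ?_) hr0.le)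
    exact abs_supSum_le huc n (C := 0) (by simp) z
  have hmarkov := mul_meas_ge_le_integral_of_nonneg
    (Filter.Eventually.of_forall fun z => (Real.exp_pos (r * supSum u n 0 z)).le) hint
    (Real.exp (r * (n * ε / 4)))
  have hsub : {S : Fin n → Z | ∃ j, n * ε / 4 < ∑ i, ((∫ z, f j z ∂μ) - f j (S i))} ⊆
      {S | Real.exp (r * (n * ε / 4)) ≤ Real.exp (r * supSum u n 0 S)} := by
    rintro S ⟨j, hj⟩
    refine Real.exp_le_exp.2 (mul_le_mul_of_nonneg_left ?_ hr0.le)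
    refine hj.le.trans (le_trans ?_ (le_iSup_finite (fun j => (0 : ι → ℝ) j + ∑ i, u j (S i)) j))
    simp [hu]
  rw [ENNReal.le_ofReal_iff_toReal_le (measure_ne_top _ _) (Real.exp_pos _).le]
  refine (measureReal_mono hsub).trans ?_
  have h1 := hmarkov.trans hmgf
  rw [mul_comm, ← le_div_iff₀ (Real.exp_pos _), ← Real.exp_sub] at h1
  refine h1.trans (Real.exp_le_exp.2 ?_)
  have h2 := mul_le_mul_of_nonneg_left hmean hr0.le
  have h3 : r * (n * ε / 8) + n * (r ^ 2 * (2 * b) ^ 2 / 2) - r * (n * ε / 4) =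
      -(n * ε ^ 2 / (512 * b ^ 2)) := by
    rw [hr]; field_simp; ring
  linarith

/-- Tail bound for the uniform deviation over a family with a separable continuous
parametrisation. -/
theorem measure_exists_deviation_le {J : Type*} [TopologicalSpace J]
    [TopologicalSpace.SeparableSpace J] [Nonempty J]
    {f : J → Z → ℝ} {l : J → K → H} (hb0 : 0 < b) (hε : 0 < ε)
    (hf : ∀ j, Measurable (f j)) (hb : ∀ j z, |f j z| ≤ b) (hcont : ∀ z, Continuous fun j => f j z)
    (hcont' : Continuous fun j => ∫ z, f j z ∂μ)
    (hV : ∀ k, Measurable (V k)) (hB : ∀ k z, ‖V k z‖ ≤ B k) (hl : ∀ j k, ‖l j k‖ ≤ R)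
    (h : ∀ j j' z, |f j z - f j' z| ≤ ∑ k, |inner ℝ (l j k) (V k z) - inner ℝ (l j' k) (V k z)|)
    {n : ℕ} (hn : 16 * Fintype.card K * R * ∑ k, B k ≤ √n * ε) :
    (Measure.pi fun _ : Fin n => μ)
        {S | ∃ j, n * ε / 4 < ∑ i, ((∫ z, f j z ∂μ) - f j (S i))} ≤
      ENNReal.ofReal (Real.exp (-(n * ε ^ 2 / (512 * b ^ 2)))) := by
  set e := TopologicalSpace.denseSeq J
  have hset : {S : Fin n → Z | ∃ j, n * ε / 4 < ∑ i, ((∫ z, f j z ∂μ) - f j (S i))} =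
      ⋃ N : ℕ, {S | ∃ j : Fin (N + 1), n * ε / 4 < ∑ i, ((∫ z, f (e j) z ∂μ) - f (e j) (S i))} := by
    ext S
    simp only [Set.mem_ofPred_eq, Set.mem_iUnion]
    constructor
    · rintro ⟨j, hj⟩
      -- The strict inequality makes the set of violating parameters open, so it meets the dense
      -- sequence. The event is then an increasing union over initial segments, with a bound
      -- independent of their length; length `N + 1` keeps them nonempty.
      have ho : IsOpen {j | n * ε / 4 < ∑ i, ((∫ z, f j z ∂μ) - f j (S i))} :=
        isOpen_lt continuous_const (continuous_finsetSum _ fun i _ => hcont'.sub (hcont _))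
      obtain ⟨j', hj', N, rfl⟩ := (TopologicalSpace.denseRange_denseSeq J).inter_open_nonempty _ ho
        ⟨j, hj⟩
      exact ⟨N, Fin.last N, by simpa using hj'⟩
    · rintro ⟨N, j, hj⟩
      exact ⟨e j, hj⟩
  rw [hset, Monotone.measure_iUnion]
  · refine iSup_le fun N => ?_
    exact measure_exists_deviation_le_of_finite μ (f := fun j : Fin (N + 1) => f (e j))
      (l := fun j => l (e j)) hb0 hε (fun j => hf _) (fun j => hb _) hV hB (fun j => hl _)
      (fun j j' => h _ _) hn
  · intro N M hNM S
    rintro ⟨j, hj⟩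
    exact ⟨j.castLE (by omega), hj⟩

end UniformDeviation

/-! ### Lipschitz continuity of the quantal response -/

section Softmax

variable {X A L : Type*} [Fintype A] (β : ℝ) (f : X → A → L → ℝ)

theorem smoothRule_nonneg (ℓ : L) (x : X) (a : A) : 0 ≤ smoothRule β f ℓ x a :=
  div_nonneg (Real.exp_pos _).le (Finset.sum_nonneg fun _ _ => (Real.exp_pos _).le)

theorem sum_smoothRule_le_one (ℓ : L) (x : X) : ∑ a, smoothRule β f ℓ x a ≤ 1 := by
  unfold smoothRule
  rw [← Finset.sum_div]
  exact div_self_le_one _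

/-- The quantal response changes by a factor of at most `e^{2 β Δ}` if all loss estimates change by
at most `Δ`. -/
theorem smoothRule_le_exp_mul (hβ : 0 ≤ β) {ℓ ℓ' : L} {x : X} {Δ : ℝ}
    (h : ∀ a, |f x a ℓ - f x a ℓ'| ≤ Δ) (a : A) :
    smoothRule β f ℓ x a ≤ Real.exp (2 * (β * Δ)) * smoothRule β f ℓ' x a := by
  have hsum : ∀ ℓ, 0 < ∑ a', Real.exp (-β * f x a' ℓ) := fun ℓ =>
    Finset.sum_pos (fun _ _ => Real.exp_pos _) ⟨a, Finset.mem_univ a⟩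
  -- Numerator and normaliser each contribute one factor `e^{βΔ}`.
  have h1 : Real.exp (-β * f x a ℓ) ≤ Real.exp (β * Δ) * Real.exp (-β * f x a ℓ') := by
    rw [← Real.exp_add]
    refine Real.exp_le_exp.2 ?_
    nlinarith [mul_le_mul_of_nonneg_left (abs_le.1 (h a)).1 hβ]
  have h2 : ∑ a', Real.exp (-β * f x a' ℓ') ≤
      Real.exp (β * Δ) * ∑ a', Real.exp (-β * f x a' ℓ) := by
    rw [Finset.mul_sum]
    refine Finset.sum_le_sum fun b _ => ?_
    rw [← Real.exp_add]
    refine Real.exp_le_exp.2 ?_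
    nlinarith [mul_le_mul_of_nonneg_left (abs_le.1 (h b)).2 hβ]
  unfold smoothRule
  rw [← mul_div_assoc, div_le_div_iff₀ (hsum ℓ) (hsum ℓ')]
  calc _ ≤ (Real.exp (β * Δ) * Real.exp (-β * f x a ℓ')) *
        (Real.exp (β * Δ) * ∑ a', Real.exp (-β * f x a' ℓ)) :=
        mul_le_mul h1 h2 (hsum ℓ').le (by positivity)
    _ = _ := by
        rw [two_mul, Real.exp_add]; ring

/-- Uses `1 - e^{-t} ≤ t` on the multiplicative comparison. The error is proportional to the
probability of `a`, so summing over actions costs no factor `|A|`. -/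
theorem smoothRule_sub_le (hβ : 0 ≤ β) {ℓ ℓ' : L} {x : X} {Δ : ℝ}
    (h : ∀ a, |f x a ℓ - f x a ℓ'| ≤ Δ) (a : A) :
    smoothRule β f ℓ x a - smoothRule β f ℓ' x a ≤ 2 * (β * Δ) * smoothRule β f ℓ x a := by
  have h1 := smoothRule_le_exp_mul β f hβ (ℓ := ℓ') (ℓ' := ℓ)
    (fun a => by rw [abs_sub_comm]; exact h a) a
  have h2 := smoothRule_le_exp_mul β f hβ h a
  have h3 := smoothRule_nonneg β f ℓ x a
  have h5 := Real.one_sub_le_exp_neg (2 * (β * Δ))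
  have h6 : Real.exp (-(2 * (β * Δ))) * smoothRule β f ℓ x a ≤ smoothRule β f ℓ' x a := by
    have := mul_le_mul_of_nonneg_left h2 (Real.exp_pos (-(2 * (β * Δ)))).le
    rwa [← mul_assoc (Real.exp _), ← Real.exp_add, neg_add_cancel, Real.exp_zero, one_mul] at this
  nlinarith [mul_le_mul_of_nonneg_right h5 h3]

/-- The quantal response is Lipschitz in the loss estimates. -/
theorem sum_abs_smoothRule_sub_le (hβ : 0 ≤ β) {ℓ ℓ' : L} {x : X} {Δ : ℝ} (hΔ : 0 ≤ Δ)
    (h : ∀ a, |f x a ℓ - f x a ℓ'| ≤ Δ) :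
    ∑ a, |smoothRule β f ℓ x a - smoothRule β f ℓ' x a| ≤ 4 * (β * Δ) := by
  have hβΔ : 0 ≤ β * Δ := mul_nonneg hβ hΔ
  have key : ∀ a, |smoothRule β f ℓ x a - smoothRule β f ℓ' x a| ≤
      2 * (β * Δ) * smoothRule β f ℓ x a + 2 * (β * Δ) * smoothRule β f ℓ' x a := fun a => by
    have h1 := smoothRule_sub_le β f hβ h a
    have h2 := smoothRule_sub_le β f hβ (ℓ := ℓ') (ℓ' := ℓ)
      (fun a => by rw [abs_sub_comm]; exact h a) a
    have h3 := mul_nonneg (mul_nonneg two_pos.le hβΔ) (smoothRule_nonneg β f ℓ x a)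
    have h4 := mul_nonneg (mul_nonneg two_pos.le hβΔ) (smoothRule_nonneg β f ℓ' x a)
    rw [abs_le]
    constructor <;> linarith
  refine (Finset.sum_le_sum fun a _ => key a).trans ?_
  rw [Finset.sum_add_distrib, ← Finset.mul_sum, ← Finset.mul_sum]
  have h1 := mul_le_mul_of_nonneg_left (sum_smoothRule_le_one β f ℓ x) (mul_nonneg two_pos.le hβΔ)
  have h2 := mul_le_mul_of_nonneg_left (sum_smoothRule_le_one β f ℓ' x) (mul_nonneg two_pos.le hβΔ)
  linarith

end Softmax

/-! ### The gap functional: Lipschitz bound and uniform deviation -/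

section Gap

variable {X Y A H : Type*} [Fintype A] [NormedAddCommGroup H] [InnerProductSpace ℝ H]
  [CompleteSpace H] [RKHS ℝ H Y ℝ] {β R₁ R₂ : ℝ} {p : X → H}

omit [CompleteSpace H] in
theorem norm_sum_smoothRule_smul_le {L : Type*} (β : ℝ) (f : X → A → L → ℝ) (ℓ' : L) (x : X)
    {d : A → H} {R : ℝ} (hR : 0 ≤ R) (hd : ∀ a, ‖d a‖ ≤ R) :
    ‖∑ a, smoothRule β f ℓ' x a • d a‖ ≤ R := by
  refine (norm_sum_le _ _).trans ?_
  calc _ ≤ ∑ a, smoothRule β f ℓ' x a * R := Finset.sum_le_sum fun a _ => by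
        rw [norm_smul, Real.norm_of_nonneg (smoothRule_nonneg β f ℓ' x a)]
        exact mul_le_mul_of_nonneg_left (hd a) (smoothRule_nonneg β f ℓ' x a)
    _ ≤ R := by
        rw [← Finset.sum_mul]
        exact mul_le_of_le_one_left hR (sum_smoothRule_le_one β f ℓ' x)

theorem norm_residual_le (hφ : ∀ y : Y, ‖featureMap H y‖ ≤ R₂) (hp : ∀ x, ‖p x‖ ≤ R₂)
    (z : X × Y) : ‖featureMap H z.2 - p z.1‖ ≤ 2 * R₂ := by
  rw [two_mul]
  exact (norm_sub_le _ _).trans (add_le_add (hφ _) (hp _))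

theorem gap_eq_sum (β : ℝ) (p : X → H) (ℓ ℓ' : A → H) (z : X × Y) :
    gap β p ℓ ℓ' z = ∑ a, smoothRule β (lossEstimator p) ℓ' z.1 a *
      inner ℝ (ℓ a) (featureMap H z.2 - p z.1) := by
  simp [gap, sum_inner, real_inner_smul_left]

theorem gap_neg (β : ℝ) (p : X → H) (ℓ ℓ' : A → H) (z : X × Y) :
    gap β p (-ℓ) ℓ' z = -gap β p ℓ ℓ' z := by
  simp [gap_eq_sum]

theorem abs_gap_le (hR₁ : 0 ≤ R₁) (hφ : ∀ y : Y, ‖featureMap H y‖ ≤ R₂) (hp : ∀ x, ‖p x‖ ≤ R₂)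
    {ℓ : A → H} (hℓ : ℓ ∈ lossClass A H R₁) (ℓ' : A → H) (z : X × Y) :
    |gap β p ℓ ℓ' z| ≤ 2 * R₁ * R₂ := by
  refine (abs_real_inner_le_norm _ _).trans ?_
  rw [show 2 * R₁ * R₂ = R₁ * (2 * R₂) by ring]
  exact mul_le_mul (norm_sum_smoothRule_smul_le β _ ℓ' z.1 hR₁ hℓ) (norm_residual_le hφ hp z)
    (norm_nonneg _) hR₁

/-- The gap is Lipschitz in finitely many linear functionals of the pair of losses. -/
theorem abs_gap_sub_gap_le (hβ : 0 ≤ β) (hR₁ : 0 ≤ R₁) (hR₂ : 0 ≤ R₂)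
    (hφ : ∀ y : Y, ‖featureMap H y‖ ≤ R₂)
    (hp : ∀ x, ‖p x‖ ≤ R₂) {ℓ₁ ℓ₂ : A → H} (h₁ : ℓ₁ ∈ lossClass A H R₁) (ℓ₁' ℓ₂' : A → H)
    (z : X × Y) :
    |gap β p ℓ₁ ℓ₁' z - gap β p ℓ₂ ℓ₂' z| ≤
      ∑ a, |inner ℝ (ℓ₁ a) (featureMap H z.2 - p z.1) -
          inner ℝ (ℓ₂ a) (featureMap H z.2 - p z.1)| +
        ∑ a, |inner ℝ (ℓ₁' a) ((8 * β * R₁ * R₂) • p z.1) -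
          inner ℝ (ℓ₂' a) ((8 * β * R₁ * R₂) • p z.1)| := by
  set k := smoothRule β (lossEstimator p) (L := A → H)
  set v := featureMap H z.2 - p z.1 with hv
  set Δ := ∑ a, |inner ℝ (ℓ₁' a) (p z.1) - inner ℝ (ℓ₂' a) (p z.1)| with hΔ
  have hΔ0 : 0 ≤ Δ := Finset.sum_nonneg fun _ _ => abs_nonneg _
  have hk : ∑ a, |k ℓ₁' z.1 a - k ℓ₂' z.1 a| ≤ 4 * (β * Δ) :=
    sum_abs_smoothRule_sub_le β _ hβ hΔ0 fun a =>
      Finset.single_le_sum (f := fun a => |inner ℝ (ℓ₁' a) (p z.1) - inner ℝ (ℓ₂' a) (p z.1)|)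
        (fun _ _ => abs_nonneg _) (Finset.mem_univ a)
  have hin : ∀ a, |inner ℝ (ℓ₁ a) v| ≤ R₁ * (2 * R₂) := fun a =>
    (abs_real_inner_le_norm _ _).trans
      (mul_le_mul (h₁ a) (norm_residual_le hφ hp z) (norm_nonneg _) hR₁)
  have hk1 : ∀ a, k ℓ₂' z.1 a ≤ 1 := fun a =>
    (Finset.single_le_sum (f := fun a => k ℓ₂' z.1 a)
      (fun a _ => smoothRule_nonneg β _ ℓ₂' z.1 a) (Finset.mem_univ a)).trans
      (sum_smoothRule_le_one β _ ℓ₂' z.1)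
  -- First the loss changes under the fixed rule of `ℓ₂'`, then the rule changes against the fixed
  -- loss `ℓ₁`. The second part costs the softmax constant `4β` times the bound `2 R₁ R₂`, which is
  -- the scaling `8 β R₁ R₂` of `p`.
  have e : gap β p ℓ₁ ℓ₁' z - gap β p ℓ₂ ℓ₂' z =
      ∑ a, k ℓ₂' z.1 a * (inner ℝ (ℓ₁ a) v - inner ℝ (ℓ₂ a) v) +
        ∑ a, (k ℓ₁' z.1 a - k ℓ₂' z.1 a) * inner ℝ (ℓ₁ a) v := by
    rw [gap_eq_sum, gap_eq_sum, ← Finset.sum_sub_distrib, ← Finset.sum_add_distrib]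
    exact Finset.sum_congr rfl fun a _ => by ring
  rw [e]
  refine (abs_add_le _ _).trans (add_le_add ?_ ?_)
  · refine (Finset.abs_sum_le_sum_abs _ _).trans (Finset.sum_le_sum fun a _ => ?_)
    rw [abs_mul, abs_of_nonneg (smoothRule_nonneg β _ ℓ₂' z.1 a)]
    exact mul_le_of_le_one_left (abs_nonneg _) (hk1 a)
  · have e2 : ∑ a, |inner ℝ (ℓ₁' a) ((8 * β * R₁ * R₂) • p z.1) -
          inner ℝ (ℓ₂' a) ((8 * β * R₁ * R₂) • p z.1)| = (8 * β * R₁ * R₂) * Δ := by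
      rw [hΔ, Finset.mul_sum]
      refine Finset.sum_congr rfl fun a _ => ?_
      rw [inner_smul_right, inner_smul_right, ← mul_sub, abs_mul, abs_of_nonneg (by positivity)]
    rw [e2]
    calc _ ≤ ∑ a, |k ℓ₁' z.1 a - k ℓ₂' z.1 a| * (R₁ * (2 * R₂)) :=
          (Finset.abs_sum_le_sum_abs _ _).trans (Finset.sum_le_sum fun a _ => by
            rw [abs_mul]; exact mul_le_mul_of_nonneg_left (hin a) (abs_nonneg _))
      _ ≤ 4 * (β * Δ) * (R₁ * (2 * R₂)) := by
          rw [← Finset.sum_mul]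
          exact mul_le_mul_of_nonneg_right hk (by positivity)
      _ = _ := by ring

theorem continuous_gap (p : X → H) (z : X × Y) :
    Continuous fun q : (A → H) × (A → H) => gap β p q.1 q.2 z := by
  simp only [gap_eq_sum, smoothRule, lossEstimator]
  refine continuous_finsetSum _ fun a _ => Continuous.mul (Continuous.div ?_ ?_ ?_) ?_
  · fun_prop
  · fun_prop
  · exact fun q => (Finset.sum_pos (fun _ _ => Real.exp_pos _) ⟨a, Finset.mem_univ a⟩).ne'
  · fun_prop

variable [MeasurableSpace X] [MeasurableSpace Y] [MeasurableSpace H] [BorelSpace H]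
  [SecondCountableTopology H]

theorem measurable_gap (hφ : Measurable (featureMap H : Y → H)) (hp : Measurable p)
    (ℓ ℓ' : A → H) : Measurable (gap β p ℓ ℓ' : X × Y → ℝ) := by
  have e : (gap β p ℓ ℓ' : X × Y → ℝ) = fun z => _ := funext fun z => gap_eq_sum β p ℓ ℓ' z
  rw [e]
  simp only [smoothRule, lossEstimator]
  fun_prop

theorem continuous_integral_gap (D : Measure (X × Y)) [IsProbabilityMeasure D] (hR₁ : 0 ≤ R₁)
    (hφm : Measurable (featureMap H : Y → H)) (hφ : ∀ y : Y, ‖featureMap H y‖ ≤ R₂)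
    (hpm : Measurable p) (hp : ∀ x, ‖p x‖ ≤ R₂) :
    Continuous fun j : (lossClass A H R₁ ×ˢ lossClass A H R₁ : Set _) =>
      ∫ z, gap β p j.1.1 j.1.2 z ∂D :=
  continuous_of_dominated (bound := fun _ => 2 * R₁ * R₂)
    (fun _ => (measurable_gap hφm hpm _ _).aestronglyMeasurable)
    (fun j => Filter.Eventually.of_forall fun z => abs_gap_le hR₁ hφ hp j.2.1 _ z)
    (integrable_const _)
    (Filter.Eventually.of_forall fun z => (continuous_gap p z).comp continuous_subtype_val)

/-- Uniform deviation of the empirical gap over all pairs of losses. -/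
theorem measure_exists_gap_deviation_le {n : ℕ} {ε : ℝ} (D : Measure (X × Y))
    [IsProbabilityMeasure D] (hβ : 0 < β) (hR₁ : 0 < R₁) (hR₂ : 0 < R₂) (hε : 0 < ε)
    (hφm : Measurable (featureMap H : Y → H)) (hφ : ∀ y : Y, ‖featureMap H y‖ ≤ R₂)
    (hpm : Measurable p) (hp : ∀ x, ‖p x‖ ≤ R₂)
    (hn : 64 * Fintype.card A ^ 2 * R₁ * R₂ * (1 + 4 * R₁ * R₂ * β) ≤ √n * ε) :
    (Measure.pi fun _ : Fin n => D)
        {S | ∃ ℓ ∈ lossClass A H R₁, ∃ ℓ' ∈ lossClass A H R₁,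
          n * ε / 4 < ∑ i, ((∫ z, gap β p ℓ ℓ' z ∂D) - gap β p ℓ ℓ' (S i))} ≤
      ENNReal.ofReal (Real.exp (-(n * ε ^ 2 / (2048 * (R₁ ^ 2 * R₂ ^ 2))))) := by
  -- The general bound needs a nonempty index set `A ⊕ A`; without actions every gap is zero.
  rcases isEmpty_or_nonempty A with hA | hA
  · have : {S : Fin n → X × Y | ∃ ℓ ∈ lossClass A H R₁, ∃ ℓ' ∈ lossClass A H R₁,
        n * ε / 4 < ∑ i, ((∫ z, gap β p ℓ ℓ' z ∂D) - gap β p ℓ ℓ' (S i))} = ∅ := by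
      ext S
      simp only [gap_eq_sum, Finset.univ_eq_empty, Finset.sum_empty, integral_zero, sub_self,
        Finset.sum_const_zero, Set.mem_ofPred_eq, Set.mem_empty_iff_false, iff_false]
      rintro ⟨_, _, _, _, h⟩
      have : 0 ≤ n * ε / 4 := by positivity
      linarith
    rw [this]
    simp
  let J := lossClass A H R₁ ×ˢ lossClass A H R₁
  have : Nonempty J := ⟨⟨(0, 0), fun a => by simpa using hR₁.le, fun a => by simpa using hR₁.le⟩⟩
  have hcont : ∀ z : X × Y, Continuous fun j : J => gap β p j.1.1 j.1.2 z := fun z =>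
    (continuous_gap p z).comp continuous_subtype_val
  have hb : ∀ (j : J) (z : X × Y), |gap β p j.1.1 j.1.2 z| ≤ 2 * R₁ * R₂ := fun j z =>
    abs_gap_le hR₁.le hφ hp j.2.1 _ z
  have hcont' : Continuous fun j : J => ∫ z, gap β p j.1.1 j.1.2 z ∂D :=
    continuous_integral_gap D hR₁.le hφm hφ hpm hp
  have key := measure_exists_deviation_le D (K := A ⊕ A) (b := 2 * R₁ * R₂) (R := R₁) (n := n)
    (V := Sum.elim (fun _ z => featureMap H z.2 - p z.1)
      (fun _ z => (8 * β * R₁ * R₂) • p z.1))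
    (B := Sum.elim (fun _ => 2 * R₂) (fun _ => (8 * β * R₁ * R₂) * R₂))
    (f := fun (j : J) z => gap β p j.1.1 j.1.2 z)
    (l := fun j => Sum.elim j.1.1 j.1.2) (by positivity) hε
    (fun j => measurable_gap hφm hpm _ _) hb hcont hcont' ?_ ?_ ?_ ?_ ?_
  · convert key using 4
    · simp [J, and_assoc]
    · ring
  · rintro (a | a)
    · exact (hφm.comp measurable_snd).sub (hpm.comp measurable_fst)
    · exact (hpm.comp measurable_fst).const_smul _
  · rintro (a | a) z
    · exact norm_residual_le hφ hp z
    · simp only [Sum.elim_inr]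
      rw [norm_smul, Real.norm_of_nonneg (by positivity)]
      exact mul_le_mul_of_nonneg_left (hp _) (by positivity)
  · rintro j (a | a)
    · exact j.2.1 a
    · exact j.2.2 a
  · intro j j' z
    rw [Fintype.sum_sum_type]
    exact abs_gap_sub_gap_le hβ.le hR₁.le hR₂.le hφ hp j.2.1 _ _ z
  · refine le_trans (le_of_eq ?_) hn
    simp only [Fintype.card_sum, Fintype.sum_sum_type, Sum.elim_inl, Sum.elim_inr,
      Finset.sum_const, Finset.card_univ, nsmul_eq_mul, Nat.cast_add]
    ring

end Gap

/-! ### Projection onto a ball -/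

section ProjBall

variable {H : Type*} [NormedAddCommGroup H] [InnerProductSpace ℝ H]

theorem norm_projBall_le {R : ℝ} (hR : 0 ≤ R) (v : H) : ‖projBall R v‖ ≤ R := by
  unfold projBall
  split_ifs with h
  · exact h
  · have : 0 < ‖v‖ := lt_of_le_of_lt hR (not_le.1 h)
    rw [norm_smul, Real.norm_of_nonneg (by positivity), div_mul_cancel₀ _ this.ne']

/-- If `v` lies outside the ball, Cauchy-Schwarz on `⟪v, w⟫` shows that the two squared distances
differ by at least `(‖v‖ - R)²`. -/
theorem norm_projBall_sub_sq_le {R : ℝ} (hR : 0 ≤ R) (v : H) {w : H} (hw : ‖w‖ ≤ R) :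
    ‖projBall R v - w‖ ^ 2 ≤ ‖v - w‖ ^ 2 := by
  unfold projBall
  split_ifs with h
  · exact le_rfl
  · have hv : R < ‖v‖ := not_le.1 h
    have h0 : 0 < ‖v‖ := lt_of_le_of_lt hR hv
    rw [norm_sub_sq_real, norm_sub_sq_real, norm_smul, Real.norm_of_nonneg (by positivity),
      div_mul_cancel₀ _ h0.ne', real_inner_smul_left]
    have h1 : inner ℝ v w ≤ ‖v‖ * R :=
      (real_inner_le_norm v w).trans (mul_le_mul_of_nonneg_left hw h0.le)
    have h2 : 0 ≤ 1 - R / ‖v‖ := by rw [sub_nonneg, div_le_one h0]; exact hv.le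
    have h3 := mul_le_mul_of_nonneg_left h1 h2
    have h4 : (1 - R / ‖v‖) * (‖v‖ * R) = (‖v‖ - R) * R := by field_simp
    nlinarith [sq_nonneg (‖v‖ - R)]

theorem measurable_projBall [MeasurableSpace H] [BorelSpace H] (R : ℝ) :
    Measurable (projBall R : H → H) := by
  unfold projBall
  exact Measurable.ite (measurableSet_le measurable_norm measurable_const) measurable_id
    ((measurable_const.div measurable_norm).smul measurable_id)

end ProjBall

/-! ### Finite kernel expansions -/

section FiniteExpansion

variable {X Y H : Type*} [NormedAddCommGroup H] [InnerProductSpace ℝ H] [CompleteSpace H]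
  [RKHS ℝ H Y ℝ] {p q : X → H}

theorem hasFiniteExpansion_zero : HasFiniteExpansion (fun _ : X => (0 : H)) :=
  ⟨0, Fin.elim0, Fin.elim0, fun x => by simp⟩

theorem hasFiniteExpansion_featureMap (y : Y) :
    HasFiniteExpansion (fun _ : X => featureMap H y) :=
  ⟨1, fun _ _ => 1, fun _ => y, fun x => by simp⟩

theorem HasFiniteExpansion.add (hp : HasFiniteExpansion p) (hq : HasFiniteExpansion q) :
    HasFiniteExpansion fun x => p x + q x := by
  obtain ⟨N, α, y, h⟩ := hp
  obtain ⟨M, α', y', h'⟩ := hq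
  refine ⟨N + M, Fin.append α α', Fin.append y y', fun x => ?_⟩
  simp [Fin.sum_univ_add, h, h']

theorem HasFiniteExpansion.smul (hp : HasFiniteExpansion p) (c : X → ℝ) :
    HasFiniteExpansion fun x => c x • p x := by
  obtain ⟨N, α, y, h⟩ := hp
  exact ⟨N, fun i x => c x * α i x, y, fun x => by simp [h, Finset.smul_sum, mul_smul]⟩

theorem HasFiniteExpansion.sub (hp : HasFiniteExpansion p) (hq : HasFiniteExpansion q) :
    HasFiniteExpansion fun x => p x - q x := by
  simpa [sub_eq_add_neg] using hp.add (hq.smul fun _ => -1)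

theorem HasFiniteExpansion.sum {I : Type*} (s : Finset I) {f : I → X → H}
    (hf : ∀ i, HasFiniteExpansion (f i)) : HasFiniteExpansion fun x => ∑ i ∈ s, f i x := by
  classical
  induction s using Finset.induction_on with
  | empty => simpa using hasFiniteExpansion_zero
  | insert i s hi ih =>
    simp only [Finset.sum_insert hi]
    exact (hf i).add ih

theorem HasFiniteExpansion.const_apply (hp : HasFiniteExpansion p) (x₀ : X) :
    HasFiniteExpansion fun _ : X => p x₀ := by
  obtain ⟨N, α, y, h⟩ := hp
  exact ⟨N, fun i _ => α i x₀, y, fun _ => h x₀⟩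

/-- Each adjustment is a fixed combination of `φ(y)` and `p(x)` at the sample points, both finite
expansions, and the projection only multiplies by a scalar depending on `x`. -/
theorem HasFiniteExpansion.update {A : Type*} [Fintype A] {n : ℕ} (hp : HasFiniteExpansion p)
    (β R₁ R₂ η : ℝ) (ℓ' : A → H) (S : Fin n → X × Y) :
    HasFiniteExpansion (update β R₁ R₂ η p ℓ' S) := by
  have hadj : ∀ a, HasFiniteExpansion fun _ : X => adjustment β R₁ η p ℓ' S a := fun a => by
    refine HasFiniteExpansion.smul (HasFiniteExpansion.smul (HasFiniteExpansion.sum _ fun i => ?_)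
      fun _ => (n : ℝ)⁻¹) fun _ => _
    exact ((hasFiniteExpansion_featureMap _).sub (hp.const_apply _)).smul fun _ => _
  have hpatch := hp.add (HasFiniteExpansion.sum Finset.univ fun a =>
    (hadj a).smul fun x => smoothRule β (lossEstimator p) ℓ' x a)
  classical
  convert hpatch.smul fun x =>
    if ‖p x + ∑ a, smoothRule β (lossEstimator p) ℓ' x a • adjustment β R₁ η p ℓ' S a‖ ≤ R₂ then 1
    else R₂ / ‖p x + ∑ a, smoothRule β (lossEstimator p) ℓ' x a • adjustment β R₁ η p ℓ' S a‖
    using 2 with x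
  unfold DimFreeDeCal.update projBall
  split_ifs <;> simp

end FiniteExpansion

/-! ### Progress of one round and the meaning of the stopping test -/

section Progress

variable {X Y A H : Type*} [Fintype A] [NormedAddCommGroup H] [InnerProductSpace ℝ H]
  [CompleteSpace H] [RKHS ℝ H Y ℝ] {β R₁ R₂ η ε : ℝ} {p : X → H} {n : ℕ}

theorem empMean_gap (β : ℝ) (p : X → H) (ℓ ℓ' : A → H) (S : Fin n → X × Y) :
    empMean S (gap β p ℓ ℓ') = ∑ a, inner ℝ (ℓ a) (empMean S fun z =>
      smoothRule β (lossEstimator p) ℓ' z.1 a • (featureMap H z.2 - p z.1)) := by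
  simp only [empMean, gap_eq_sum, inner_smul_right, inner_sum, smul_eq_mul, ← Finset.mul_sum]
  rw [Finset.sum_comm]

/-- The best response `a ↦ R₁ v_a / ‖v_a‖` to the decision rule of `ℓ'` on the batch `S`. -/
noncomputable def bestResponse (β R₁ : ℝ) (p : X → H) (ℓ' : A → H) (S : Fin n → X × Y) :
    A → H :=
  adjustment β R₁ 1 p ℓ' S

theorem adjustment_eq_smul_bestResponse (β R₁ η : ℝ) (p : X → H) (ℓ' : A → H)
    (S : Fin n → X × Y) (a : A) :
    adjustment β R₁ η p ℓ' S a = η • bestResponse β R₁ p ℓ' S a := by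
  simp [bestResponse, adjustment, smul_smul, mul_div_assoc]

theorem bestResponse_mem_lossClass (hR₁ : 0 ≤ R₁) (β : ℝ) (p : X → H) (ℓ' : A → H)
    (S : Fin n → X × Y) : bestResponse β R₁ p ℓ' S ∈ lossClass A H R₁ := fun a => by
  simp only [bestResponse, adjustment, one_mul]
  rw [norm_smul, Real.norm_of_nonneg (by positivity)]
  rw [div_mul_eq_mul_div, mul_div_assoc]
  exact mul_le_of_le_one_right hR₁ (div_self_le_one _)

/-- For fixed `ℓ'` the empirical gap is linear in `ℓ` and separates over actions, so Cauchy-Schwarz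
is sharp at `R₁ v_a / ‖v_a‖`. Hence the update can ignore the first loss returned by the oracle. -/
theorem empMean_gap_le_bestResponse (β : ℝ) (p : X → H) {ℓ : A → H} (hℓ : ℓ ∈ lossClass A H R₁)
    (ℓ' : A → H) (S : Fin n → X × Y) :
    empMean S (gap β p ℓ ℓ') ≤ empMean S (gap β p (bestResponse β R₁ p ℓ' S) ℓ') := by
  rw [empMean_gap, empMean_gap]
  refine Finset.sum_le_sum fun a _ => ?_
  simp only [bestResponse, adjustment, one_mul]
  set v : H := empMean S fun z =>
      smoothRule β (lossEstimator p) ℓ' z.1 a • (featureMap H z.2 - p z.1)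
  rw [real_inner_smul_left, real_inner_self_eq_norm_sq]
  refine (real_inner_le_norm _ _).trans ?_
  rcases eq_or_ne ‖v‖ 0 with h | h
  · simp [h]
  · rw [show R₁ / ‖v‖ * ‖v‖ ^ 2 = R₁ * ‖v‖ by field_simp]
    exact mul_le_mul_of_nonneg_right (hℓ a) (norm_nonneg _)

variable [MeasurableSpace X] [MeasurableSpace Y] [MeasurableSpace H] [BorelSpace H]
  [SecondCountableTopology H] (D : Measure (X × Y)) [IsProbabilityMeasure D]

theorem integrable_gap (hR₁ : 0 ≤ R₁) (hφm : Measurable (featureMap H : Y → H))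
    (hφ : ∀ y : Y, ‖featureMap H y‖ ≤ R₂) (hpm : Measurable p) (hp : ∀ x, ‖p x‖ ≤ R₂)
    {ℓ : A → H} (hℓ : ℓ ∈ lossClass A H R₁) (ℓ' : A → H) : Integrable (gap β p ℓ ℓ') D :=
  integrable_of_abs_le (measurable_gap hφm hpm ℓ ℓ') (abs_gap_le hR₁ hφ hp hℓ ℓ')

theorem integrable_sq_error (hφm : Measurable (featureMap H : Y → H))
    (hφ : ∀ y : Y, ‖featureMap H y‖ ≤ R₂) (hpm : Measurable p) (hp : ∀ x, ‖p x‖ ≤ R₂) :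
    Integrable (fun z : X × Y => ‖p z.1 - featureMap H z.2‖ ^ 2) D := by
  refine integrable_of_abs_le (((hpm.comp measurable_fst).sub
    (hφm.comp measurable_snd)).norm.pow_const 2) (C := (2 * R₂) ^ 2) fun z => ?_
  rw [abs_of_nonneg (by positivity), norm_sub_rev]
  exact pow_le_pow_left₀ (norm_nonneg _) (norm_residual_le hφ hp z) 2

theorem meanSquaredError_le (hφm : Measurable (featureMap H : Y → H))
    (hφ : ∀ y : Y, ‖featureMap H y‖ ≤ R₂) (hpm : Measurable p) (hp : ∀ x, ‖p x‖ ≤ R₂) :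
    meanSquaredError D p ≤ 4 * R₂ ^ 2 := by
  have h := integral_mono (integrable_sq_error D hφm hφ hpm hp)
    (integrable_const ((2 * R₂) ^ 2)) fun z => by
      simp only [norm_sub_rev (p _)]
      exact pow_le_pow_left₀ (norm_nonneg _) (norm_residual_le hφ hp z) 2
  simp only [integral_const, probReal_univ, one_smul] at h
  rw [meanSquaredError]
  linarith

/-- Joint measurability in parameter and point is essential: the adjustment evaluates `P ω` at
sample points that themselves depend on `ω`. -/
theorem measurable_update (hφm : Measurable (featureMap H : Y → H)) {Ω : Type*}
    [MeasurableSpace Ω] {P : Ω → X → H} (hP : Measurable (Function.uncurry P)) {q : Ω → A → H}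
    (hq : Measurable q) {S : Ω → Fin n → X × Y} (hS : Measurable S) :
    Measurable (fun ω : Ω × X => update β R₁ R₂ η (P ω.1) (q ω.1) (S ω.1) ω.2) := by
  have hqa : ∀ a, Measurable fun ω => q ω a := fun a => (measurable_pi_apply a).comp hq
  have hk : ∀ a, Measurable fun ω : Ω × X =>
      smoothRule β (lossEstimator (P ω.1)) (q ω.1) ω.2 a := fun a => by
    have hin : ∀ a, Measurable fun ω : Ω × X => inner ℝ (q ω.1 a) (P ω.1 ω.2) := fun a =>
      ((hqa a).comp measurable_fst).inner hP
    exact (Real.measurable_exp.comp ((hin a).const_mul (-β))).div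
      (Finset.measurable_sum _ fun a _ => Real.measurable_exp.comp ((hin a).const_mul (-β)))
  have hSi : ∀ i, Measurable fun ω => S ω i := fun i => (measurable_pi_apply i).comp hS
  have hv : ∀ a, Measurable fun ω => empMean (S ω) fun z =>
      smoothRule β (lossEstimator (P ω)) (q ω) z.1 a • (featureMap H z.2 - P ω z.1) := fun a => by
    refine (Finset.measurable_sum _ fun i _ => ?_).const_smul _
    have hx : Measurable fun ω => (ω, (S ω i).1) := measurable_id.prodMk (hSi i).fst
    exact ((hk a).comp hx).smul ((hφm.comp (hSi i).snd).sub (hP.comp hx))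
  have hadj : ∀ a, Measurable fun ω => adjustment β R₁ η (P ω) (q ω) (S ω) a := fun a =>
    ((hv a).norm.const_div (η * R₁)).smul (hv a)
  refine (measurable_projBall R₂).comp (hP.add (Finset.measurable_sum _ fun a _ => ?_))
  exact (hk a).smul ((hadj a).comp measurable_fst)

/-- Patching by the adjustment decreases the mean squared error in proportion to the expected gap
of the best response. -/
theorem meanSquaredError_update_le (hR₁ : 0 ≤ R₁) (hR₂ : 0 ≤ R₂) (hη : 0 ≤ η)
    (hφm : Measurable (featureMap H : Y → H))
    (hφ : ∀ y : Y, ‖featureMap H y‖ ≤ R₂) (hpm : Measurable p) (hp : ∀ x, ‖p x‖ ≤ R₂)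
    (ℓ' : A → H) (S : Fin n → X × Y) :
    meanSquaredError D (update β R₁ R₂ η p ℓ' S) ≤ meanSquaredError D p
      - 2 * η * ∫ z, gap β p (bestResponse β R₁ p ℓ' S) ℓ' z ∂D + η ^ 2 * R₁ ^ 2 := by
  set ℓ := bestResponse β R₁ p ℓ' S with hℓ
  have hmem : ℓ ∈ lossClass A H R₁ := bestResponse_mem_lossClass hR₁ β p ℓ' S
  have hpt : ∀ z : X × Y, ‖update β R₁ R₂ η p ℓ' S z.1 - featureMap H z.2‖ ^ 2 ≤
      ‖p z.1 - featureMap H z.2‖ ^ 2 - 2 * η * gap β p ℓ ℓ' z + η ^ 2 * R₁ ^ 2 := fun z => by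
    refine (norm_projBall_sub_sq_le hR₂ _ (hφ z.2)).trans ?_
    simp only [adjustment_eq_smul_bestResponse, smul_comm _ η, ← Finset.smul_sum, ← hℓ]
    set s := ∑ a, smoothRule β (lossEstimator p) ℓ' z.1 a • ℓ a with hs
    have h1 : ‖s‖ ≤ R₁ := norm_sum_smoothRule_smul_le β _ ℓ' z.1 hR₁ hmem
    have h2 : gap β p ℓ ℓ' z = -inner ℝ (p z.1 - featureMap H z.2) s := by
      rw [gap, ← hs, real_inner_comm, ← inner_neg_left, neg_sub]
    have h3 : ‖s‖ ^ 2 ≤ R₁ ^ 2 := pow_le_pow_left₀ (norm_nonneg _) h1 2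
    rw [add_sub_right_comm, norm_add_sq_real, inner_smul_right, norm_smul, mul_pow,
      Real.norm_of_nonneg hη, h2]
    nlinarith [mul_le_mul_of_nonneg_left h3 (sq_nonneg η)]
  have hgi := (integrable_gap (β := β) D hR₁ hφm hφ hpm hp hmem ℓ').const_mul (2 * η)
  have hei := integrable_sq_error D hφm hφ hpm hp
  -- Only the dominating side has to be integrable, so measurability of the updated predictor is not
  -- needed here.
  have h := integral_mono_of_nonneg (μ := D)
    (Filter.Eventually.of_forall fun z : X × Y =>
      sq_nonneg ‖update β R₁ R₂ η p ℓ' S z.1 - featureMap H z.2‖)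
    ((hei.sub hgi).add (integrable_const (η ^ 2 * R₁ ^ 2)))
    (Filter.Eventually.of_forall hpt)
  refine h.trans (le_of_eq ?_)
  rw [integral_add' (hei.sub hgi) (integrable_const _), integral_sub' hei hgi, integral_const_mul]
  simp [meanSquaredError]

/-- The empirical gaps on `S` of all pairs of losses are within `ε / 4` of their expectations
(stated without division by the batch size). -/
def HasSmallDeviation (D : Measure (X × Y)) (β R₁ ε : ℝ) (p : X → H) (S : Fin n → X × Y) (A : Type*)
    [Fintype A] : Prop :=
  ∀ ℓ ∈ lossClass A H R₁, ∀ ℓ' ∈ lossClass A H R₁,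
    ∑ i, ((∫ z, gap β p ℓ ℓ' z ∂D) - gap β p ℓ ℓ' (S i)) ≤ n * ε / 4

omit [CompleteSpace H] [RKHS ℝ H Y ℝ] [MeasurableSpace X] [MeasurableSpace Y] [MeasurableSpace H]
  [BorelSpace H] [SecondCountableTopology H] [Fintype A] [InnerProductSpace ℝ H] in
theorem neg_mem_lossClass {ℓ : A → H} (h : ℓ ∈ lossClass A H R₁) : -ℓ ∈ lossClass A H R₁ :=
  fun a => by simpa using h a

omit [MeasurableSpace H] [BorelSpace H] [SecondCountableTopology H] [IsProbabilityMeasure D] in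
-- The lower bound is the upper bound for `-ℓ`, since the class is symmetric and the gap is odd in
-- `ℓ`.
theorem HasSmallDeviation.abs_sub_le {D : Measure (X × Y)} {S : Fin n → X × Y} (hn : 0 < n)
    (h : HasSmallDeviation D β R₁ ε p S A) {ℓ ℓ' : A → H} (hℓ : ℓ ∈ lossClass A H R₁)
    (hℓ' : ℓ' ∈ lossClass A H R₁) :
    |(∫ z, gap β p ℓ ℓ' z ∂D) - empMean S (gap β p ℓ ℓ')| ≤ ε / 4 := by
  have hn' : (0 : ℝ) < n := by exact_mod_cast hn
  have key : ∀ ℓ ∈ lossClass A H R₁,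
      (∫ z, gap β p ℓ ℓ' z ∂D) - empMean S (gap β p ℓ ℓ') ≤ ε / 4 := fun ℓ hℓ => by
    have h1 := h ℓ hℓ ℓ' hℓ'
    rw [Finset.sum_sub_distrib, Finset.sum_const, Finset.card_univ, Fintype.card_fin,
      nsmul_eq_mul] at h1
    have h2 : n * empMean S (gap β p ℓ ℓ') = ∑ i, gap β p ℓ ℓ' (S i) := by
      rw [empMean, smul_eq_mul, mul_inv_cancel_left₀ hn'.ne']
    rw [← h2, mul_div_assoc, ← mul_sub] at h1
    exact le_of_mul_le_mul_left h1 hn'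
  refine abs_le.2 ⟨?_, key ℓ hℓ⟩
  have h1 := key (-ℓ) (neg_mem_lossClass hℓ)
  simp only [gap_neg, integral_neg, empMean, Finset.sum_neg_distrib, smul_neg] at h1 ⊢
  linarith

omit [MeasurableSpace H] [BorelSpace H] [SecondCountableTopology H] [IsProbabilityMeasure D] in
theorem loopTest_iff {p : X → H} : LoopTest (lossClass A H R₁) D β ε p ↔
    ∃ ℓ ∈ lossClass A H R₁, ∃ ℓ' ∈ lossClass A H R₁, ε < ∫ z, gap β p ℓ ℓ' z ∂D := by
  simp only [LoopTest, lt_iSup_iff, EReal.coe_lt_coe_iff, exists_prop]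

omit [MeasurableSpace H] [BorelSpace H] [SecondCountableTopology H] [IsProbabilityMeasure D] in
theorem HasSmallDeviation.exists_isWitness {D : Measure (X × Y)} {S : Fin n → X × Y} (hn : 0 < n)
    (h : HasSmallDeviation D β R₁ ε p S A) (ht : LoopTest (lossClass A H R₁) D β ε p) :
    ∃ q, IsWitness (lossClass A H R₁) β ε p S q := by
  obtain ⟨ℓ, hℓ, ℓ', hℓ', hgt⟩ := (loopTest_iff D).1 ht
  refine ⟨(ℓ, ℓ'), hℓ, hℓ', ?_⟩
  have := (abs_le.1 (h.abs_sub_le hn hℓ hℓ')).2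
  dsimp only
  linarith

/-- Progress of one successful round. -/
theorem HasSmallDeviation.meanSquaredError_update_le {S : Fin n → X × Y} (hn : 0 < n)
    (h : HasSmallDeviation D β R₁ ε p S A) (hR₁ : 0 < R₁) (hR₂ : 0 ≤ R₂) (hε : 0 < ε)
    (hη : η = ε / (2 * R₁ ^ 2)) (hφm : Measurable (featureMap H : Y → H))
    (hφ : ∀ y : Y, ‖featureMap H y‖ ≤ R₂) (hpm : Measurable p) (hp : ∀ x, ‖p x‖ ≤ R₂)
    {q : (A → H) × (A → H)} (hq : IsWitness (lossClass A H R₁) β ε p S q) :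
    meanSquaredError D (update β R₁ R₂ η p q.2 S) ≤
      meanSquaredError D p - ε ^ 2 / (4 * R₁ ^ 2) := by
  obtain ⟨hq1, hq2, hq3⟩ := hq
  have hη0 : 0 < η := by rw [hη]; positivity
  have h1 := DimFreeDeCal.meanSquaredError_update_le (β := β) D hR₁.le hR₂ hη0.le hφm hφ hpm hp
    q.2 S
  have h2 := empMean_gap_le_bestResponse β p hq1 q.2 S
  have h3 := (abs_le.1 (h.abs_sub_le hn (bestResponse_mem_lossClass hR₁.le β p q.2 S) hq2)).1
  have h4 : ε / 2 ≤ ∫ z, gap β p (bestResponse β R₁ p q.2 S) q.2 z ∂D := by linarith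
  have h5 := mul_le_mul_of_nonneg_left h4 (mul_nonneg two_pos.le hη0.le)
  have h6 : 2 * η * (ε / 2) - η ^ 2 * R₁ ^ 2 = ε ^ 2 / (4 * R₁ ^ 2) := by
    rw [hη]; field_simp; ring
  linarith

/-- A predictor that fails the loop test is decision calibrated. -/
theorem isDecCalibrated_of_not_loopTest (hR₁ : 0 ≤ R₁) (hφm : Measurable (featureMap H : Y → H))
    (hφ : ∀ y : Y, ‖featureMap H y‖ ≤ R₂) (hpm : Measurable p) (hp : ∀ x, ‖p x‖ ≤ R₂)
    (h : ¬ LoopTest (lossClass A H R₁) D β ε p) :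
    IsDecCalibrated D (lossEstimator p) (lossClass A H R₁)
      (smoothRules β (lossEstimator p) (lossClass A H R₁)) ε := by
  rw [loopTest_iff] at h
  push Not at h
  refine iSup₂_le fun ℓ hℓ => iSup₂_le ?_
  rintro _ ⟨ℓ', hℓ', rfl⟩
  refine ENNReal.ofReal_le_ofReal ?_
  have hev : ∀ (a : A) (y : Y), ℓ a y = inner ℝ (ℓ a) (featureMap H y) := fun a y => by
    rw [featureMap, RKHS.inner_kerFun]; simp
  have hkm : ∀ a, Measurable fun z : X × Y => smoothRule β (lossEstimator p) ℓ' z.1 a := fun a => by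
    simp only [smoothRule, lossEstimator]; fun_prop
  have hint : ∀ v : X × Y → H, Measurable v → (∀ z, ‖v z‖ ≤ R₂) → Integrable
      (fun z : X × Y => ∑ a, smoothRule β (lossEstimator p) ℓ' z.1 a * inner ℝ (ℓ a) (v z)) D :=
    fun v hv hvb => by
      refine integrable_of_abs_le (Finset.measurable_sum _ fun a _ =>
        (hkm a).mul (measurable_const.inner hv)) (C := R₁ * R₂) fun z => ?_
      have e : ∑ a, smoothRule β (lossEstimator p) ℓ' z.1 a * inner ℝ (ℓ a) (v z) =
          inner ℝ (∑ a, smoothRule β (lossEstimator p) ℓ' z.1 a • ℓ a) (v z) := by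
        simp [sum_inner, real_inner_smul_left]
      rw [e]
      exact (abs_real_inner_le_norm _ _).trans (mul_le_mul
        (norm_sum_smoothRule_smul_le β _ ℓ' z.1 hR₁ hℓ) (hvb z) (norm_nonneg _) hR₁)
  -- By the reproducing property both expected losses are expectations of inner products with `ℓ a`,
  -- and their difference is the expected gap.
  have e : (∫ z : X × Y, ∑ a, smoothRule β (lossEstimator p) ℓ' z.1 a * ℓ a z.2 ∂D) -
      ∫ z : X × Y, ∑ a, smoothRule β (lossEstimator p) ℓ' z.1 a * lossEstimator p z.1 a ℓ ∂D =
      ∫ z, gap β p ℓ ℓ' z ∂D := by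
    simp only [hev, lossEstimator]
    rw [← integral_sub (hint (fun z => featureMap H z.2) (hφm.comp measurable_snd) fun z => hφ _)
      (hint (fun z => p z.1) (hpm.comp measurable_fst) fun z => hp _)]
    simp only [gap_eq_sum, ← Finset.sum_sub_distrib, ← mul_sub, inner_sub_right]
  rw [e]
  refine abs_le.2 ⟨?_, h ℓ hℓ ℓ' hℓ'⟩
  have h1 := h (-ℓ) (neg_mem_lossClass hℓ) ℓ' hℓ'
  simp only [gap_neg, integral_neg] at h1
  linarith

end Progress

/-! ### Resampling one coordinate of an infinite product -/

section InfiniteProduct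

variable {Ω : ℕ → Type*} [∀ t, MeasurableSpace (Ω t)] (ν : ∀ t, Measure (Ω t))
  [∀ t, IsProbabilityMeasure (ν t)]

theorem measurable_update_pair (t : ℕ) :
    Measurable fun q : (∀ t, Ω t) × Ω t => Function.update q.1 t q.2 := by
  refine measurable_pi_lambda _ fun s => ?_
  rcases eq_or_ne s t with rfl | h
  · simpa using measurable_snd
  · simp only [Function.update_of_ne h]
    exact (measurable_pi_apply s).comp measurable_fst

/-- Resampling one coordinate does not change an infinite product measure. -/
theorem map_update_infinitePi (t : ℕ) :
    ((Measure.infinitePi ν).prod (ν t)).map (fun q => Function.update q.1 t q.2) =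
      Measure.infinitePi ν := by
  refine Measure.eq_infinitePi ν fun s T hT => ?_
  rw [Measure.map_apply (measurable_update_pair t)
    (MeasurableSet.pi s.countable_toSet fun i _ => hT i)]
  -- The preimage of a cylinder is a rectangle: coordinate `t` is read from the fresh sample, the
  -- rest from the old stream. If `t ∉ s`, the second factor is the whole space.
  have hpre : (fun q : (∀ t, Ω t) × Ω t => Function.update q.1 t q.2) ⁻¹' (s : Set ℕ).pi T =
      ((s.erase t : Finset ℕ) : Set ℕ).pi T ×ˢ {x | t ∈ s → x ∈ T t} := by
    ext ⟨S, x⟩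
    simp only [Set.mem_preimage, Set.mem_pi, Set.mem_prod, Finset.coe_erase, Set.mem_ofPred_eq,
      Set.mem_sdiff, Set.mem_singleton_iff, Finset.mem_coe]
    constructor
    · intro h
      refine ⟨fun i hi => ?_, fun ht => by simpa using h t ht⟩
      simpa [Function.update_of_ne hi.2] using h i hi.1
    · rintro ⟨h1, h2⟩ i hi
      rcases eq_or_ne i t with rfl | hne
      · simpa using h2 hi
      · simpa [Function.update_of_ne hne] using h1 i ⟨hi, hne⟩
  rw [hpre, Measure.prod_prod, Measure.infinitePi_pi ν fun i _ => hT i]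
  by_cases ht : t ∈ s
  · simp only [ht, true_imp_iff, Set.ofPred_mem_eq]
    rw [mul_comm, Finset.mul_prod_erase s (fun i => ν i (T i)) ht]
  · simp [ht]

/-- An event is unlikely if it is unlikely given all coordinates but one. -/
theorem infinitePi_le_of_update_le (t : ℕ) {E : Set (∀ t, Ω t)} (hE : MeasurableSet E) {c : ℝ≥0∞}
    (h : ∀ S, ν t {x | Function.update S t x ∈ E} ≤ c) : Measure.infinitePi ν E ≤ c := by
  rw [← map_update_infinitePi ν t, Measure.map_apply (measurable_update_pair t) hE,
    Measure.prod_apply (measurable_update_pair t hE)]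
  calc _ ≤ ∫⁻ _, c ∂(Measure.infinitePi ν) := lintegral_mono fun S => h S
    _ = c := by simp

end InfiniteProduct

/-! ### The adaptive run of the algorithm -/

section Algorithm

variable {X Y A H : Type*} [MeasurableSpace X] [MeasurableSpace Y] [Fintype A]
  [NormedAddCommGroup H] [InnerProductSpace ℝ H] [CompleteSpace H] [MeasurableSpace H]
  [BorelSpace H] [SecondCountableTopology H] [RKHS ℝ H Y ℝ] {n : ℕ} {D : Measure (X × Y)}
  [IsProbabilityMeasure D] {β R₁ R₂ η ε : ℝ} {p₀ : X → H} {aud : Oracle n X Y A H}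

omit [Fintype A] [NormedAddCommGroup H] [InnerProductSpace ℝ H] [CompleteSpace H] [BorelSpace H]
  [SecondCountableTopology H] [RKHS ℝ H Y ℝ] in
theorem measurable_query (haud : ∀ t, Measurable (aud t)) (t : ℕ) :
    Measurable fun S : ℕ → Fin n → X × Y => aud.query S t :=
  (haud t).comp (measurable_pi_lambda _ fun _ => measurable_pi_apply _)

theorem measurable_predictorSeq_uncurry (hφm : Measurable (featureMap H : Y → H))
    (hpm : Measurable p₀) (haud : ∀ t, Measurable (aud t)) (t : ℕ) :
    Measurable (Function.uncurry fun S => predictorSeq β R₁ R₂ η p₀ aud S t) := by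
  induction t with
  | zero => exact hpm.comp measurable_snd
  | succ t ih =>
    have h := measurable_update (β := β) (R₁ := R₁) (R₂ := R₂) (η := η) hφm ih
      (q := fun S => (aud.query S t).2) (measurable_query haud t).snd
      (S := fun S => S t) (measurable_pi_apply t)
    exact h

theorem measurable_predictorSeq (hφm : Measurable (featureMap H : Y → H))
    (hpm : Measurable p₀) (haud : ∀ t, Measurable (aud t)) (S : ℕ → Fin n → X × Y) (t : ℕ) :
    Measurable (predictorSeq β R₁ R₂ η p₀ aud S t) :=
  (measurable_predictorSeq_uncurry hφm hpm haud t).comp (measurable_const.prodMk measurable_id)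

omit [MeasurableSpace X] [MeasurableSpace Y] [MeasurableSpace H] [BorelSpace H]
  [SecondCountableTopology H] in
theorem norm_predictorSeq_le (hR₂ : 0 ≤ R₂) (hp : ∀ x, ‖p₀ x‖ ≤ R₂) (S : ℕ → Fin n → X × Y)
    (t : ℕ) (x : X) : ‖predictorSeq β R₁ R₂ η p₀ aud S t x‖ ≤ R₂ := by
  cases t with
  | zero => exact hp x
  | succ t => exact norm_projBall_le hR₂ _

omit [MeasurableSpace X] [MeasurableSpace Y] [MeasurableSpace H] [BorelSpace H]
  [SecondCountableTopology H] in
theorem HasFiniteExpansion.predictorSeq (hp : HasFiniteExpansion p₀) (S : ℕ → Fin n → X × Y)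
    (t : ℕ) : HasFiniteExpansion (predictorSeq β R₁ R₂ η p₀ aud S t) := by
  induction t with
  | zero => exact hp
  | succ t ih => exact ih.update β R₁ R₂ η _ _

omit [MeasurableSpace X] [MeasurableSpace Y] [MeasurableSpace H] [BorelSpace H]
  [SecondCountableTopology H] in
-- The predictor of round `s` reads only batches before `s`, so batch `t` is still fresh for the
-- predictor of round `t`.
theorem predictorSeq_update (S : ℕ → Fin n → X × Y) (t : ℕ) (x : Fin n → X × Y) {s : ℕ}
    (hs : s ≤ t) : predictorSeq β R₁ R₂ η p₀ aud (Function.update S t x) s =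
      predictorSeq β R₁ R₂ η p₀ aud S s := by
  induction s with
  | zero => rfl
  | succ s ih =>
    have hq : aud.query (Function.update S t x) s = aud.query S s := by
      unfold Oracle.query
      congr 1
      funext i
      exact Function.update_of_ne (by omega) _ _
    rw [DimFreeDeCal.predictorSeq, DimFreeDeCal.predictorSeq, ih (by omega), hq,
      Function.update_of_ne (by omega)]

/-- The pair of losses of a countable dense family suffice to test for small deviation. -/
theorem exists_countable_hasSmallDeviation_iff (D : Measure (X × Y)) [IsProbabilityMeasure D]
    (β ε : ℝ) (hR₁ : 0 ≤ R₁) (hφm : Measurable (featureMap H : Y → H))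
    (hφ : ∀ y : Y, ‖featureMap H y‖ ≤ R₂) :
    ∃ e : ℕ → (A → H) × (A → H), ∀ (p : X → H), Measurable p → (∀ x, ‖p x‖ ≤ R₂) →
      ∀ S : Fin n → X × Y, HasSmallDeviation D β R₁ ε p S A ↔
        ∀ k, ∑ i, ((∫ z, gap β p (e k).1 (e k).2 z ∂D) - gap β p (e k).1 (e k).2 (S i)) ≤
          n * ε / 4 := by
  let J := lossClass A H R₁ ×ˢ lossClass A H R₁
  have : Nonempty J := ⟨⟨(0, 0), fun a => by simpa using hR₁, fun a => by simpa using hR₁⟩⟩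
  -- The dense sequence is chosen before `p`, because the predictor varies with the stream.
  refine ⟨fun k => (TopologicalSpace.denseSeq J k).1, fun p hpm hp S => ⟨fun h k => ?_, fun h => ?_⟩⟩
  · exact h _ (TopologicalSpace.denseSeq J k).2.1 _ (TopologicalSpace.denseSeq J k).2.2
  · have hcont' : Continuous fun j : J => ∫ z, gap β p j.1.1 j.1.2 z ∂D :=
      continuous_integral_gap D hR₁ hφm hφ hpm hp
    have hcl : IsClosed {j : J | ∑ i, ((∫ z, gap β p j.1.1 j.1.2 z ∂D) -
        gap β p j.1.1 j.1.2 (S i)) ≤ n * ε / 4} :=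
      isClosed_le (continuous_finsetSum _ fun i _ =>
        hcont'.sub ((continuous_gap p _).comp continuous_subtype_val)) continuous_const
    intro ℓ hℓ ℓ' hℓ'
    exact (TopologicalSpace.denseRange_denseSeq J).induction_on
      (p := fun j : J => ∑ i, ((∫ z, gap β p j.1.1 j.1.2 z ∂D) -
        gap β p j.1.1 j.1.2 (S i)) ≤ n * ε / 4) ⟨(ℓ, ℓ'), hℓ, hℓ'⟩ hcl h

/-- Needed to integrate over the resampled batch. The uncountable quantifier over losses becomes a
countable intersection. -/
theorem measurableSet_hasSmallDeviation (hR₁ : 0 ≤ R₁) (hR₂ : 0 ≤ R₂)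
    (hφm : Measurable (featureMap H : Y → H))
    (hφ : ∀ y : Y, ‖featureMap H y‖ ≤ R₂) (hpm : Measurable p₀) (hp : ∀ x, ‖p₀ x‖ ≤ R₂)
    (haud : ∀ t, Measurable (aud t)) (t : ℕ) :
    MeasurableSet {S : ℕ → Fin n → X × Y |
      HasSmallDeviation D β R₁ ε (predictorSeq β R₁ R₂ η p₀ aud S t) (S t) A} := by
  obtain ⟨e, he⟩ := exists_countable_hasSmallDeviation_iff (A := A) (n := n) D β ε hR₁ hφm hφ
  simp only [he _ (measurable_predictorSeq hφm hpm haud _ t) (norm_predictorSeq_le hR₂ hp _ t)]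
  have hP := measurable_predictorSeq_uncurry (β := β) (R₁ := R₁) (R₂ := R₂) (η := η) hφm hpm haud t
  have hg : ∀ ℓ ℓ' : A → H, Measurable fun q : (ℕ → Fin n → X × Y) × (X × Y) =>
      gap β (predictorSeq β R₁ R₂ η p₀ aud q.1 t) ℓ ℓ' q.2 := fun ℓ ℓ' => by
    have hPx : Measurable fun q : (ℕ → Fin n → X × Y) × (X × Y) =>
        predictorSeq β R₁ R₂ η p₀ aud q.1 t q.2.1 :=
      hP.comp (measurable_fst.prodMk measurable_snd.fst)
    simp only [gap_eq_sum, smoothRule, lossEstimator]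
    fun_prop
  rw [Set.ofPred_forall]
  refine MeasurableSet.iInter fun k => ?_
  refine measurableSet_le (Finset.measurable_sum _ fun i _ => Measurable.sub ?_ ?_) measurable_const
  · exact (hg _ _).stronglyMeasurable.integral_prod_right.measurable
  · have hSi : Measurable fun S : ℕ → Fin n → X × Y => (S, S t i) :=
      measurable_id.prodMk ((measurable_pi_apply i).comp (measurable_pi_apply t))
    have h := (hg (e k).1 (e k).2).comp hSi
    exact h

/-- Probability of a large deviation in round `t`. -/
theorem infinitePi_not_hasSmallDeviation_le (hβ : 0 < β) (hR₁ : 0 < R₁) (hR₂ : 0 < R₂)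
    (hε : 0 < ε) (hφm : Measurable (featureMap H : Y → H))
    (hφ : ∀ y : Y, ‖featureMap H y‖ ≤ R₂) (hpm : Measurable p₀) (hp : ∀ x, ‖p₀ x‖ ≤ R₂)
    (haud : ∀ t, Measurable (aud t))
    (hn : 64 * Fintype.card A ^ 2 * R₁ * R₂ * (1 + 4 * R₁ * R₂ * β) ≤ √n * ε) (t : ℕ) :
    Measure.infinitePi (fun _ : ℕ => Measure.pi fun _ : Fin n => D)
        {S | ¬ HasSmallDeviation D β R₁ ε (predictorSeq β R₁ R₂ η p₀ aud S t) (S t) A} ≤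
      ENNReal.ofReal (Real.exp (-(n * ε ^ 2 / (2048 * (R₁ ^ 2 * R₂ ^ 2))))) := by
  refine infinitePi_le_of_update_le _ t
    (measurableSet_hasSmallDeviation hR₁.le hR₂.le hφm hφ hpm hp haud t).compl fun S => ?_
  refine (measure_mono fun x hx => ?_).trans (measure_exists_gap_deviation_le D hβ hR₁ hR₂ hε hφm hφ
    (measurable_predictorSeq (β := β) (R₁ := R₁) (R₂ := R₂) (η := η) hφm hpm haud S t)
    (norm_predictorSeq_le hR₂.le hp S t) hn)
  have hx' : ¬ HasSmallDeviation D β R₁ ε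
      (predictorSeq β R₁ R₂ η p₀ aud (Function.update S t x) t) (Function.update S t x t) A := hx
  rw [predictorSeq_update _ _ _ le_rfl, Function.update_self] at hx'
  rw [Set.mem_ofPred_eq]
  simpa only [HasSmallDeviation, not_forall, not_le, exists_prop] using hx'

/-- The guarantee of the algorithm on a stream of batches with small deviation in all rounds. -/
theorem exists_haltsAt_of_hasSmallDeviation (hn : 0 < n) (hR₁ : 0 < R₁) (hR₂ : 0 < R₂)
    (hε : 0 < ε) (hη : η = ε / (2 * R₁ ^ 2)) (hφm : Measurable (featureMap H : Y → H))
    (hφ : ∀ y : Y, ‖featureMap H y‖ ≤ R₂) (hpm : Measurable p₀) (hp : ∀ x, ‖p₀ x‖ ≤ R₂)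
    (haud : IsAuditor D β R₁ R₂ η ε p₀ aud) {S : ℕ → Fin n → X × Y}
    (hS : ∀ t < ⌊16 * R₁ ^ 2 * R₂ ^ 2 / ε ^ 2⌋₊ + 1,
      HasSmallDeviation D β R₁ ε (predictorSeq β R₁ R₂ η p₀ aud S t) (S t) A) :
    ∃ T : ℕ, HaltsAt D β R₁ R₂ η ε p₀ aud S T ∧ (T : ℝ) ≤ 16 * R₁ ^ 2 * R₂ ^ 2 / ε ^ 2 ∧
      meanSquaredError D (predictorSeq β R₁ R₂ η p₀ aud S T) ≤ meanSquaredError D p₀ := by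
  set N := ⌊16 * R₁ ^ 2 * R₂ ^ 2 / ε ^ 2⌋₊ + 1 with hN
  set P := predictorSeq β R₁ R₂ η p₀ aud S with hP
  have hdrop0 : 0 < ε ^ 2 / (4 * R₁ ^ 2) := by positivity
  have hwit : ∀ t < N, LoopTest (lossClass A H R₁) D β ε (P t) →
      IsWitness (lossClass A H R₁) β ε (P t) (S t) (aud.query S t) := fun t ht hl =>
    haud.finds S t hl ((hS t ht).exists_isWitness hn hl)
  have hdrop : ∀ T ≤ N, (∀ t < T, LoopTest (lossClass A H R₁) D β ε (P t)) →
      meanSquaredError D (P T) ≤ meanSquaredError D p₀ - T * (ε ^ 2 / (4 * R₁ ^ 2)) := by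
    intro T hT hl
    induction T with
    | zero => simp [hP, predictorSeq]
    | succ T ih =>
      have h1 := ih (by omega) fun t ht => hl t (by omega)
      have h2 := (hS T (by omega)).meanSquaredError_update_le D hn hR₁ hR₂.le hε hη hφm hφ
        (measurable_predictorSeq hφm hpm haud.measurable S T) (norm_predictorSeq_le hR₂.le hp S T)
        (hwit T (by omega) (hl T (by omega)))
      have h3 : meanSquaredError D (P (T + 1)) ≤
        meanSquaredError D (P T) - ε ^ 2 / (4 * R₁ ^ 2) := h2
      push_cast
      linarith
  -- The rounding up makes `N` exceed the bound strictly, so `N` successful rounds would push the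
  -- mean squared error below zero.
  have hex : ∃ T, T < N ∧ ¬ LoopTest (lossClass A H R₁) D β ε (P T) := by
    by_contra! hcon
    have h1 := hdrop N le_rfl hcon
    have h2 := meanSquaredError_le D hφm hφ hpm hp
    have h3 : 0 ≤ meanSquaredError D (P N) := integral_nonneg fun z => by positivity
    have h4 : 16 * R₁ ^ 2 * R₂ ^ 2 / ε ^ 2 < N := by
      rw [hN]; push_cast; exact Nat.lt_floor_add_one _
    have h5 := mul_lt_mul_of_pos_right h4 hdrop0
    have h6 : 16 * R₁ ^ 2 * R₂ ^ 2 / ε ^ 2 * (ε ^ 2 / (4 * R₁ ^ 2)) = 4 * R₂ ^ 2 := by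
      field_simp; ring
    linarith
  classical
  obtain ⟨hTN, hTl⟩ := Nat.find_spec hex
  have hlt : ∀ t < Nat.find hex, LoopTest (lossClass A H R₁) D β ε (P t) := fun t ht => by
    have := Nat.find_min hex ht
    push Not at this
    exact this (ht.trans hTN)
  refine ⟨Nat.find hex, ⟨fun t ht => ⟨hlt t ht, hwit t (ht.trans hTN) (hlt t ht)⟩, hTl⟩, ?_, ?_⟩
  · exact (Nat.le_floor_iff (by positivity)).1 (by omega)
  · have h1 := hdrop _ hTN.le hlt
    have h2 : 0 ≤ (Nat.find hex : ℝ) * (ε ^ 2 / (4 * R₁ ^ 2)) := by positivity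
    linarith

omit [MeasurableSpace H] [BorelSpace H] [SecondCountableTopology H] in
/-- Without any sampling, the loop test fails at once if the tolerance is large. -/
theorem not_loopTest_of_le {p : X → H} (hR₁ : 0 ≤ R₁) (hε : 2 * R₁ * R₂ ≤ ε)
    (hφ : ∀ y : Y, ‖featureMap H y‖ ≤ R₂) (hp : ∀ x, ‖p x‖ ≤ R₂) :
    ¬ LoopTest (lossClass A H R₁) D β ε p := by
  rw [loopTest_iff]
  rintro ⟨ℓ, hℓ, ℓ', -, h⟩
  have := (abs_le.1 (abs_integral_le_of_abs_le (μ := D) (f := gap β p ℓ ℓ')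
    (abs_gap_le hR₁ hφ hp hℓ ℓ'))).2
  linarith

end Algorithm

/-! ### The batch size -/

/-- The batch size that suffices for `m` actions. -/
noncomputable def batchSize (m : ℕ) (β R₁ R₂ ε δ : ℝ) : ℕ :=
  -- For such `ε` the loop never starts, and a positive batch size would break the `ε⁻⁴` bound for
  -- large `ε`. In the other branch, `4096 = 64²` comes from squaring the expectation condition and
  -- `2048` from the tail exponent.
  if 2 * R₁ * R₂ ≤ ε then 0 else
    ⌈(R₁ * R₂ / ε) ^ 2 * (4096 * m ^ 4 * (1 + 4 * R₁ * R₂ * β) ^ 2 +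
      2048 * Real.log ((⌊16 * R₁ ^ 2 * R₂ ^ 2 / ε ^ 2⌋₊ + 1) / δ))⌉₊

section BatchSize

variable {m : ℕ} {β R₁ R₂ ε δ : ℝ}

theorem log_rounds_div_le (hR₁ : 0 < R₁) (hR₂ : 0 < R₂) (hε : 0 < ε) (hδ : 0 < δ) :
    Real.log ((⌊16 * R₁ ^ 2 * R₂ ^ 2 / ε ^ 2⌋₊ + 1) / δ) ≤
      8 * (R₁ * R₂) + 2 * Real.log (1 + 1 / ε) + Real.log (1 / δ) := by
  have h1 : (⌊16 * R₁ ^ 2 * R₂ ^ 2 / ε ^ 2⌋₊ : ℝ) + 1 ≤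
      ((1 + 4 * (R₁ * R₂)) * (1 + 1 / ε)) ^ 2 := by
    have h2 := Nat.floor_le (a := 16 * R₁ ^ 2 * R₂ ^ 2 / ε ^ 2) (by positivity)
    have h3 : 16 * R₁ ^ 2 * R₂ ^ 2 / ε ^ 2 = (4 * (R₁ * R₂) * (1 / ε)) ^ 2 := by
      field_simp; ring
    have h4 : 0 < 1 / ε := by positivity
    have h5 : 0 < R₁ * R₂ := by positivity
    have h6 : 0 < 4 * (R₁ * R₂) * (1 / ε) := by positivity
    have h7 : 1 + 4 * (R₁ * R₂) * (1 / ε) ≤ (1 + 4 * (R₁ * R₂)) * (1 + 1 / ε) := by nlinarith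
    have h8 := pow_le_pow_left₀ (by positivity) h7 2
    nlinarith
  rw [Real.log_div (by positivity) hδ.ne', one_div δ, Real.log_inv]
  have h2 := Real.log_le_log (by positivity) h1
  rw [Real.log_pow, Real.log_mul (by positivity) (by positivity)] at h2
  have h3 := Real.log_le_sub_one_of_pos (show 0 < 1 + 4 * (R₁ * R₂) by positivity)
  push_cast at h2
  linarith

/-- The constant is `4096 · 25 + 2048 · 8 + 2048 · 3 + 4`; the final `4` pays for the ceiling in
`batchSize`. -/
theorem batch_factor_le {m P L l : ℝ} (hm0 : 0 ≤ m) (hmP : m ≤ P) (hβ : 0 < β) (hβP : β ≤ P)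
    (hR₁ : 0 < R₁) (hR₂ : 0 < R₂) (hRR : R₁ * R₂ ≤ P ^ 2) (hP1 : 1 ≤ P) (hL1 : 1 ≤ L)
    (hl : l ≤ 8 * (R₁ * R₂) + 3 * L) :
    4096 * m ^ 4 * (1 + 4 * R₁ * R₂ * β) ^ 2 + 2048 * l + 4 ≤ 124932 * (P ^ 10 * L) := by
  have hP0 : 0 < P := by linarith
  have hP2 : P ^ 2 ≤ P ^ 10 := pow_le_pow_right₀ hP1 (by norm_num)
  have hP10 : 1 ≤ P ^ 10 := one_le_pow₀ hP1
  have h6 : P ^ 10 ≤ P ^ 10 * L := le_mul_of_one_le_right (by positivity) hL1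
  have h7 : L ≤ P ^ 10 * L := le_mul_of_one_le_left (by positivity) hP10
  have h1 : 1 + 4 * R₁ * R₂ * β ≤ 5 * P ^ 3 := by
    have h2 : R₁ * R₂ * β ≤ P ^ 2 * P := mul_le_mul hRR hβP hβ.le (by positivity)
    have h3 : 1 ≤ P ^ 3 := one_le_pow₀ hP1
    linarith
  have h4 : m ^ 4 * (1 + 4 * R₁ * R₂ * β) ^ 2 ≤ P ^ 4 * (5 * P ^ 3) ^ 2 :=
    mul_le_mul (pow_le_pow_left₀ hm0 hmP 4) (pow_le_pow_left₀ (by positivity) h1 2)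
      (by positivity) (by positivity)
  have h5 : P ^ 4 * (5 * P ^ 3) ^ 2 = 25 * P ^ 10 := by ring
  linarith

theorem batchSize_mul_le (hβ : 0 < β) (hR₁ : 0 < R₁) (hR₂ : 0 < R₂) (hε : 0 < ε) (hδ : 0 < δ)
    (hδ1 : δ < 1) :
    (batchSize m β R₁ R₂ ε δ : ℝ) * (16 * R₁ ^ 2 * R₂ ^ 2 / ε ^ 2) ≤
      2000000 * (1 + m + β + R₁ + R₂) ^ 18 *
        (1 + Real.log (1 + 1 / ε) + Real.log (1 / δ)) ^ 18 / ε ^ 4 := by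
  have hl1 : 0 ≤ Real.log (1 + 1 / ε) := Real.log_nonneg (by
    have : 0 < 1 / ε := by positivity
    linarith)
  have hl2 : 0 ≤ Real.log (1 / δ) :=
    Real.log_nonneg (by rw [one_div]; exact (one_le_inv₀ hδ).2 hδ1.le)
  have hlog := log_rounds_div_le hR₁ hR₂ hε hδ
  have hm0 : (0 : ℝ) ≤ m := Nat.cast_nonneg m
  have hP1 : 1 ≤ 1 + m + β + R₁ + R₂ := by linarith
  have hL1 : 1 ≤ 1 + Real.log (1 + 1 / ε) + Real.log (1 / δ) := by linarith
  have hmP : (m : ℝ) ≤ 1 + m + β + R₁ + R₂ := by linarith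
  have hβP : β ≤ 1 + m + β + R₁ + R₂ := by linarith
  have hRR : R₁ * R₂ ≤ (1 + m + β + R₁ + R₂) ^ 2 := by
    rw [sq]; exact mul_le_mul (by linarith) (by linarith) hR₂.le (by linarith)
  have hQ := batch_factor_le hm0 hmP hβ hβP hR₁ hR₂ hRR hP1 hL1
    (l := Real.log ((⌊16 * R₁ ^ 2 * R₂ ^ 2 / ε ^ 2⌋₊ + 1) / δ)) (by linarith)
  have hlog0 : 0 ≤ Real.log ((⌊16 * R₁ ^ 2 * R₂ ^ 2 / ε ^ 2⌋₊ + 1) / δ) := by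
    refine Real.log_nonneg ((one_le_div hδ).2 ?_)
    have : (0 : ℝ) ≤ ⌊16 * R₁ ^ 2 * R₂ ^ 2 / ε ^ 2⌋₊ := Nat.cast_nonneg _
    linarith
  unfold batchSize
  generalize 1 + Real.log (1 + 1 / ε) + Real.log (1 / δ) = L at *
  generalize 1 + (m : ℝ) + β + R₁ + R₂ = P at *
  generalize Real.log ((⌊16 * R₁ ^ 2 * R₂ ^ 2 / ε ^ 2⌋₊ + 1) / δ) = l at *
  have hP0 : 0 < P := by linarith
  have hL0 : 0 < L := by linarith
  split_ifs with hc
  · simp only [Nat.cast_zero, zero_mul]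
    positivity
  · have hQ0 : 0 ≤ 4096 * (m : ℝ) ^ 4 * (1 + 4 * R₁ * R₂ * β) ^ 2 + 2048 * l := by positivity
    generalize 4096 * (m : ℝ) ^ 4 * (1 + 4 * R₁ * R₂ * β) ^ 2 + 2048 * l = Q at *
    have hceil : (⌈(R₁ * R₂ / ε) ^ 2 * Q⌉₊ : ℝ) ≤ (R₁ * R₂ / ε) ^ 2 * (Q + 4) := by
      have h1 := (Nat.ceil_lt_add_one (a := (R₁ * R₂ / ε) ^ 2 * Q) (by positivity)).le
      -- Outside the trivial case the `1` lost in the ceiling is at most `4 (R₁ R₂ / ε)²`.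
      have h2 : 1 / 2 < R₁ * R₂ / ε := by rw [lt_div_iff₀ hε]; linarith
      have h3 := pow_le_pow_left₀ (by norm_num) h2.le 2
      linarith
    have hρP : (R₁ * R₂) ^ 4 ≤ P ^ 8 := by
      calc _ ≤ (P ^ 2) ^ 4 := pow_le_pow_left₀ (by positivity) hRR 4
        _ = _ := by ring
    have hLL : L ≤ L ^ 18 := le_self_pow₀ hL1 (by norm_num)
    calc _ ≤ (R₁ * R₂ / ε) ^ 2 * (124932 * (P ^ 10 * L)) * (16 * R₁ ^ 2 * R₂ ^ 2 / ε ^ 2) :=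
          mul_le_mul_of_nonneg_right (hceil.trans (mul_le_mul_of_nonneg_left hQ (by positivity)))
            (by positivity)
      _ = 1998912 * ((R₁ * R₂) ^ 4 * P ^ 10) * L / ε ^ 4 := by
          field_simp; ring
      _ ≤ 2000000 * (P ^ 8 * P ^ 10) * L ^ 18 / ε ^ 4 := by gcongr; norm_num
      _ = _ := by ring

variable {n : ℕ}

/-- The two nonnegative summands of `batchSize` each give one bound: the first controls the expected
supremum, the second the tail, with failure probability `δ` shared among the rounds. -/
theorem le_sqrt_mul_of_batchSize_le (hβ : 0 < β) (hR₁ : 0 < R₁) (hR₂ : 0 < R₂) (hε : 0 < ε)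
    (hδ : 0 < δ) (hδ1 : δ < 1) (hc : ¬ 2 * R₁ * R₂ ≤ ε) (hn : batchSize m β R₁ R₂ ε δ ≤ n) :
    0 < n ∧ 64 * (m : ℝ) ^ 2 * R₁ * R₂ * (1 + 4 * R₁ * R₂ * β) ≤ √n * ε ∧
      Real.exp (-(n * ε ^ 2 / (2048 * (R₁ ^ 2 * R₂ ^ 2)))) ≤
        δ / (⌊16 * R₁ ^ 2 * R₂ ^ 2 / ε ^ 2⌋₊ + 1) := by
  rw [batchSize, if_neg hc, Nat.ceil_le] at hn
  have hN0 : (0 : ℝ) ≤ ⌊16 * R₁ ^ 2 * R₂ ^ 2 / ε ^ 2⌋₊ := Nat.cast_nonneg _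
  set N : ℝ := ⌊16 * R₁ ^ 2 * R₂ ^ 2 / ε ^ 2⌋₊ + 1 with hN
  have hlog : 0 < Real.log (N / δ) := Real.log_pos ((one_lt_div hδ).2 (by linarith))
  have ha : (0 : ℝ) ≤ 4096 * m ^ 4 * (1 + 4 * R₁ * R₂ * β) ^ 2 := by positivity
  have hρ : 0 < (R₁ * R₂ / ε) ^ 2 := by positivity
  rw [mul_add] at hn
  have h1 := mul_nonneg hρ.le ha
  have h2 : 0 < (R₁ * R₂ / ε) ^ 2 * (2048 * Real.log (N / δ)) := by positivity
  refine ⟨?_, ?_, ?_⟩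
  · have : (0 : ℝ) < n := by linarith
    exact_mod_cast this
  · rw [← div_le_iff₀ hε]
    refine Real.le_sqrt_of_sq_le (le_trans (le_of_eq ?_) ((le_add_of_nonneg_right h2.le).trans hn))
    field_simp; ring
  · rw [Real.exp_neg, ← inv_div N δ, inv_le_inv₀ (Real.exp_pos _) (by positivity),
      ← Real.log_le_iff_le_exp (by positivity), le_div_iff₀ (by positivity)]
    have h3 := mul_le_mul_of_nonneg_right ((le_add_of_nonneg_left h1).trans hn) (sq_nonneg ε)
    refine le_trans (le_of_eq ?_) h3
    field_simp

end BatchSize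

end DimFreeDeCal

/-! ### The main theorem -/

theorem mainTheorem4 :
    ∃ (C : ℝ) (k : ℕ), 0 < C ∧
      ∀ (m : ℕ) (β R₁ R₂ ε δ : ℝ), 0 < β → 0 < R₁ → 0 < R₂ → 0 < ε → 0 < δ → δ < 1 →
      ∃ n₀ : ℕ,
        (n₀ : ℝ) * (16 * R₁ ^ 2 * R₂ ^ 2 / ε ^ 2) ≤
          C * (1 + m + β + R₁ + R₂) ^ k *
            (1 + Real.log (1 + 1 / ε) + Real.log (1 / δ)) ^ k / ε ^ 4 ∧
        ∀ (n : ℕ), n₀ ≤ n →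
        ∀ (A : Type*) [Fintype A], Fintype.card A = m →
        ∀ (X : Type*) [MeasurableSpace X]
          (d : ℕ) (Y : Set (EuclideanSpace ℝ (Fin d))), IsCompact Y → Convex ℝ Y →
        ∀ (D : Measure (X × Y)) [IsProbabilityMeasure D]
          (H : Type*) [NormedAddCommGroup H] [InnerProductSpace ℝ H] [CompleteSpace H]
          [TopologicalSpace.SeparableSpace H] [MeasurableSpace H] [BorelSpace H] [RKHS ℝ H Y ℝ],
          Measurable (DimFreeDeCal.featureMap H : Y → H) →
          (∀ y : Y, ‖DimFreeDeCal.featureMap H y‖ ≤ R₂) →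
        ∀ (p₀ : X → H), Measurable p₀ → (∀ x, ‖p₀ x‖ ≤ R₂) →
        ∀ (η : ℝ), η = ε / (2 * R₁ ^ 2) →
        ∀ (aud : DimFreeDeCal.Oracle n X Y A H),
          DimFreeDeCal.IsAuditor D β R₁ R₂ η ε p₀ aud →
          Measure.infinitePi (fun _ : ℕ => Measure.pi fun _ : Fin n => D)
            {S | ¬ ∃ T : ℕ,
              DimFreeDeCal.HaltsAt D β R₁ R₂ η ε p₀ aud S T ∧
              (T : ℝ) ≤ 16 * R₁ ^ 2 * R₂ ^ 2 / ε ^ 2 ∧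
              DimFreeDeCal.IsDecCalibrated D
                (DimFreeDeCal.lossEstimator
                  (DimFreeDeCal.predictorSeq β R₁ R₂ η p₀ aud S T))
                (DimFreeDeCal.lossClass A H R₁)
                (DimFreeDeCal.smoothRules β
                  (DimFreeDeCal.lossEstimator
                    (DimFreeDeCal.predictorSeq β R₁ R₂ η p₀ aud S T))
                  (DimFreeDeCal.lossClass A H R₁)) ε ∧
              DimFreeDeCal.meanSquaredError D (DimFreeDeCal.predictorSeq β R₁ R₂ η p₀ aud S T) ≤
                DimFreeDeCal.meanSquaredError D p₀ ∧
              (DimFreeDeCal.HasFiniteExpansion p₀ →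
                DimFreeDeCal.HasFiniteExpansion
                  (DimFreeDeCal.predictorSeq β R₁ R₂ η p₀ aud S T))} ≤ ENNReal.ofReal δ := by
  refine ⟨2000000, 18, by norm_num, fun m β R₁ R₂ ε δ hβ hR₁ hR₂ hε hδ hδ1 =>
    ⟨DimFreeDeCal.batchSize m β R₁ R₂ ε δ,
      DimFreeDeCal.batchSize_mul_le hβ hR₁ hR₂ hε hδ hδ1, ?_⟩⟩
  intro n hn A _ hA X _ d Y _ _ D _ H _ _ _ _ _ _ _ hφm hφ p₀ hpm hp η hη aud haud
  have : SecondCountableTopology H := UniformSpace.secondCountable_of_separable H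
  have hfinal : ∀ (S : ℕ → Fin n → X × Y) (T : ℕ),
      DimFreeDeCal.HaltsAt D β R₁ R₂ η ε p₀ aud S T →
      DimFreeDeCal.IsDecCalibrated D
        (DimFreeDeCal.lossEstimator (DimFreeDeCal.predictorSeq β R₁ R₂ η p₀ aud S T))
        (DimFreeDeCal.lossClass A H R₁)
        (DimFreeDeCal.smoothRules β
          (DimFreeDeCal.lossEstimator (DimFreeDeCal.predictorSeq β R₁ R₂ η p₀ aud S T))
          (DimFreeDeCal.lossClass A H R₁)) ε := fun S T hT =>
    DimFreeDeCal.isDecCalibrated_of_not_loopTest D hR₁.le hφm hφ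
      (DimFreeDeCal.measurable_predictorSeq hφm hpm haud.measurable S T)
      (DimFreeDeCal.norm_predictorSeq_le hR₂.le hp S T) hT.2
  -- In the first case `n` may be `0`; the run stops at `T = 0` on every stream, so the bad event is
  -- empty.
  by_cases hc : 2 * R₁ * R₂ ≤ ε
  · refine (measure_mono fun S hS => ?_).trans (measure_empty.trans_le zero_le)
    have h0 : DimFreeDeCal.HaltsAt D β R₁ R₂ η ε p₀ aud S 0 :=
      ⟨fun t ht => absurd ht (Nat.not_lt_zero t),
        DimFreeDeCal.not_loopTest_of_le hR₁.le hc hφ hp⟩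
    exact hS ⟨0, h0, by rw [Nat.cast_zero]; positivity, hfinal S 0 h0, le_rfl,
      fun h => h.predictorSeq S 0⟩
  · obtain ⟨hn0, hn1, hn2⟩ :=
      DimFreeDeCal.le_sqrt_mul_of_batchSize_le hβ hR₁ hR₂ hε hδ hδ1 hc hn
    rw [← hA] at hn1
    set N := ⌊16 * R₁ ^ 2 * R₂ ^ 2 / ε ^ 2⌋₊ + 1 with hN
    -- The failure event lies in the union of the `N` large-deviation events; each has probability
    -- at most `δ / N`.
    calc _ ≤ Measure.infinitePi (fun _ : ℕ => Measure.pi fun _ : Fin n => D)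
          (⋃ t ∈ Finset.range N, {S | ¬ DimFreeDeCal.HasSmallDeviation D β R₁ ε
            (DimFreeDeCal.predictorSeq β R₁ R₂ η p₀ aud S t) (S t) A}) := by
          refine measure_mono fun S hS => ?_
          by_contra hcon
          simp only [Set.mem_iUnion, Finset.mem_range, exists_prop, not_exists, not_and] at hcon
          obtain ⟨T, hT, hTle, hmse⟩ := DimFreeDeCal.exists_haltsAt_of_hasSmallDeviation hn0 hR₁
            hR₂ hε hη hφm hφ hpm hp haud (S := S) fun t ht => not_not.1 (hcon t ht)
          exact hS ⟨T, hT, hTle, hfinal S T hT, hmse, fun h => h.predictorSeq S T⟩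
      _ ≤ ∑ t ∈ Finset.range N, ENNReal.ofReal (δ / (⌊16 * R₁ ^ 2 * R₂ ^ 2 / ε ^ 2⌋₊ + 1)) :=
          (measure_biUnion_finset_le _ _).trans <| Finset.sum_le_sum fun t _ =>
            (DimFreeDeCal.infinitePi_not_hasSmallDeviation_le hβ hR₁ hR₂ hε hφm hφ hpm hp
              haud.measurable hn1 t).trans (ENNReal.ofReal_le_ofReal hn2)
      _ = ENNReal.ofReal δ := by
          rw [← ENNReal.ofReal_sum_of_nonneg fun _ _ => by positivity]
          rw [Finset.sum_const, Finset.card_range, nsmul_eq_mul, hN]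
          push_cast
          rw [mul_div_cancel₀ _ (by positivity)]
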